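/- Let $f:\mathbb T^2\to\mathbb T^2$, $\mathbb T^2=\mathbb R^2/\mathbb Z^2$, be the Cat Map given by the matrix $\begin{pmatrix}2&1\\1&1\end{pmatrix}$, with eigenvalues $\mu=\frac{3-\sqrt5}{2}$ and $\lambda=\frac{3+\sqrt5}{2}$. Use coordinates $(x,y)$ with respect to unit stable and unstable eigenvectors (the $x$-axis is stable, the $y$-axis is unstable, $(0,0)$ is the fixed point), projected to $\mathbb T^2$. Let $\epsilon,b,\beta,\sigma>0$, $a=\frac{\epsilon}{1-\mu}$ and $\varphi\in(-\frac\pi2,\frac\pi2)$. Put $$W=\{|x|<a,\ |y|<b\,e^{-x^2/2\sigma^2}\},\qquad U'=\{|x|<a+\tfrac{\beta}{2},\ |y|<(b+\beta)\,e^{-x^2/2\sigma^2}\},$$ and suppose that the projection to $\mathbb T^2$ is injective on $U'$; we then regard $W\subset U'$ as subsets of $\mathbb T^2$. Let $V$ be a $C^\infty$ unit vector field on $\mathbb T^2$ which inside $W$ is tangent to the curves $y=Ke^{-x^2/2\sigma^2}$, $K\in\mathbb R$, and outside $U'$ makes the constant angle $\varphi$ with the unstable direction, that is, $V=\pm(\sin\varphi,\cos\varphi)$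 in the coordinates $(x,y)$. Assume: - (B1) $\epsilon>3\Bigl(\sigma\sqrt{\frac{4\ln\lambda}{1-\mu^2}}+b\Bigr)$; - (B2) $\beta<\frac{\epsilon}{7}$ and $\beta\le(\lambda-1)b$; - (B3) $\frac14\beta>\frac{\epsilon\sin\varphi}{1-\mu}+(b+\beta)\exp\Bigl\{-\frac{(a+\beta)^2}{2\sigma^2}\Bigr\}\tan\varphi$. For $q\in\mathbb T^2$ let $Q_q$ be the uniform distribution (with respect to arc length) on the arc of length $2\epsilon$, centred at $q$, of the integral curve of $V$ through $q$. Let $\mathcal F$ be the Markov chain with transition probabilities $P(A|q)=Q_{f(q)}(A)$, and put $\mathcal F_*\nu=\int P(\cdot|q)\,d\nu(q)$. Then there is a Borel probability measure $m$ on $\mathbb T^2$ such that: 1. $m$ is $\mathcal F$-invariant, it is singular with respect to Lebesgue measure, it is supported on the segment $[-a,a]\times\{0\}$ of the local stable manifold of the fixed point, that is, the complement of this segment has $m$-measure zero, and $m$ is the only $\mathcal F$-invariant Borel probability measure. 2. For every Borel probability measure $\nu$ on $\mathbb T^2$, all limit points (in the weak topology) of the sequence $\mathcal F^n_*\nu$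 are supported on $[-a,a]\times\{0\}$, and $\frac1n\sum_{i=0}^{n-1}\mathcal F^i_*\nu\to m$ weakly. -/

import Mathlib

open MeasureTheory ProbabilityTheory Set Filter Topology
open scoped ContDiff NNReal

noncomputable section

namespace CatMap

/-- The two-dimensional torus `ℝ² / ℤ²`, with its Haar (Lebesgue) probability measure `volume`. -/
abbrev Torus : Type := UnitAddCircle × UnitAddCircle

/-- The contraction rate `μ = (3 - √5) / 2` of the Cat Map. -/
def mu : ℝ := (3 - √5) / 2

/-- The expansion rate `λ = (3 + √5) / 2` of the Cat Map. -/
def lam : ℝ := (3 + √5) / 2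

/-- The number `τ = (√5 - 1) / 2`: the eigenvectors of the matrix of the Cat Map are `(1, τ)`
(unstable) and `(-τ, 1)` (stable). -/
def tau : ℝ := (√5 - 1) / 2

/-- The Cat Map: `(u, v) ↦ (2u + v, u + v)` modulo one. -/
def catMap (q : Torus) : Torus := (2 • q.1 + q.2, q.1 + q.2)

/-- The covering `ℝ² → 𝕋²` in the stable-unstable frame: `(x, y)` is sent to the class of
`x • eₛ + y • eᵤ`, where `eₛ = (-τ, 1) / √(1 + τ²)` and `eᵤ = (1, τ) / √(1 + τ²)` are the unit
stable and unstable eigenvectors. -/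
def toTorus (p : ℝ × ℝ) : Torus :=
  (((-tau * p.1 + p.2) / √(1 + tau ^ 2) : ℝ), ((p.1 + tau * p.2) / √(1 + tau ^ 2) : ℝ))

/-- A `C^∞` unit vector field on the torus, given by its components in the orthonormal frame
`eₛ, eᵤ`. -/
structure UnitVectorField where
  toFun : Torus → ℝ × ℝ
  smooth : ContDiff ℝ ∞ fun p : ℝ × ℝ => toFun (toTorus p)
  unit : ∀ q, (toFun q).1 ^ 2 + (toFun q).2 ^ 2 = 1

instance : CoeFun UnitVectorField fun _ => Torus → ℝ × ℝ := ⟨UnitVectorField.toFun⟩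

/-- `c : ℝ → ℝ²` is (a lift to the plane of) an integral curve of `V`. -/
def UnitVectorField.IsIntegralCurve (V : UnitVectorField) (c : ℝ → ℝ × ℝ) : Prop :=
  ∀ t, HasDerivAt c (V (toTorus (c t))) t

/-! ### Facts on the covering -/

lemma one_add_tau_sq_pos : 0 < 1 + tau ^ 2 := by positivity

lemma toTorus_add (p h : ℝ × ℝ) : toTorus (p + h) = toTorus p + toTorus h := by
  unfold toTorus
  ext
  · simp only [Prod.fst_add, Prod.snd_add, ← AddCircle.coe_add]
    congr 1; ring
  · simp only [Prod.fst_add, Prod.snd_add, ← AddCircle.coe_add]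
    congr 1; ring

lemma continuous_toTorus : Continuous toTorus := by
  unfold toTorus
  refine Continuous.prodMk ?_ ?_
  · exact (AddCircle.continuous_mk' (1 : ℝ)).comp (by fun_prop)
  · exact (AddCircle.continuous_mk' (1 : ℝ)).comp (by fun_prop)

/-- The lift of a point of the torus to the unit square, in stable-unstable coordinates. -/
def lift (q : Torus) : ℝ × ℝ :=
  let r : ℝ := AddCircle.measurableEquivIco 1 0 q.1
  let s : ℝ := AddCircle.measurableEquivIco 1 0 q.2
  ((-tau * r + s) / √(1 + tau ^ 2), (r + tau * s) / √(1 + tau ^ 2))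

lemma measurable_lift : Measurable lift := by
  unfold lift
  have h1 : Measurable fun q : Torus => ((AddCircle.measurableEquivIco 1 0 q.1 : Ico _ _) : ℝ) :=
    measurable_subtype_coe.comp ((MeasurableEquiv.measurable _).comp measurable_fst)
  have h2 : Measurable fun q : Torus => ((AddCircle.measurableEquivIco 1 0 q.2 : Ico _ _) : ℝ) :=
    measurable_subtype_coe.comp ((MeasurableEquiv.measurable _).comp measurable_snd)
  exact (((h1.const_mul _).add h2).div_const _).prodMk ((h1.add (h2.const_mul _)).div_const _)

lemma coe_measurableEquivIco (q : UnitAddCircle) :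
    (((AddCircle.measurableEquivIco 1 0 q : Ico _ _) : ℝ) : UnitAddCircle) = q :=
  (AddCircle.equivIco 1 0).symm_apply_apply q

lemma toTorus_lift (q : Torus) : toTorus (lift q) = q := by
  have h := one_add_tau_sq_pos
  have hs : √(1 + tau ^ 2) ≠ 0 := (Real.sqrt_pos.2 h).ne'
  have hq : √(1 + tau ^ 2) * √(1 + tau ^ 2) = 1 + tau ^ 2 := Real.mul_self_sqrt h.le
  unfold toTorus lift
  ext
  · conv_rhs => rw [← coe_measurableEquivIco q.1]
    dsimp only
    congr 1
    field_simp
    rw [sq, hq]; ring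
  · conv_rhs => rw [← coe_measurableEquivIco q.2]
    dsimp only
    congr 1
    field_simp
    rw [sq, hq]; ring

lemma norm_lift_le (q : Torus) : ‖lift q‖ ≤ 2 := by
  have ht0 : 0 ≤ tau := by
    unfold tau
    have : (1 : ℝ) ≤ √5 := Real.one_le_sqrt.2 (by norm_num)
    linarith
  have ht1 : tau ≤ 1 := by
    unfold tau
    have : √5 ≤ (3 : ℝ) := Real.sqrt_le_iff.2 (by norm_num)
    linarith
  have hs : 1 ≤ √(1 + tau ^ 2) := Real.one_le_sqrt.2 (by nlinarith)
  have key : ∀ z : ℝ, |z| ≤ 2 → |z / √(1 + tau ^ 2)| ≤ 2 := by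
    intro z hz
    rw [abs_div, abs_of_pos (by linarith : 0 < √(1 + tau ^ 2)), div_le_iff₀ (by linarith)]
    linarith
  have hr := (AddCircle.measurableEquivIco 1 0 q.1).2
  have hv := (AddCircle.measurableEquivIco 1 0 q.2).2
  rw [mem_Ico] at hr hv
  rw [Prod.norm_def, max_le_iff]
  unfold lift
  constructor
  · refine key _ (abs_le.2 ⟨?_, ?_⟩) <;> nlinarith
  · refine key _ (abs_le.2 ⟨?_, ?_⟩) <;> nlinarith

namespace UnitVectorField

variable (V : UnitVectorField)

/-! ### The flow of the vector field -/

lemma norm_le_one (q : Torus) : ‖V q‖ ≤ 1 := by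
  have h := V.unit q
  rw [Prod.norm_def, max_le_iff]
  constructor <;> rw [Real.norm_eq_abs, ← sq_le_one_iff_abs_le_one]
  · nlinarith [sq_nonneg (V q).2]
  · nlinarith [sq_nonneg (V q).1]

lemma toTorus_sub_lift (p : ℝ × ℝ) : toTorus (p - lift (toTorus p)) = 0 := by
  have h := toTorus_add (p - lift (toTorus p)) (lift (toTorus p))
  rw [sub_add_cancel, toTorus_lift] at h
  simpa using h

lemma exists_lipschitz : ∃ K : ℝ≥0, LipschitzWith K fun p : ℝ × ℝ => V (toTorus p) := by
  have hc : Continuous (fderiv ℝ fun p : ℝ × ℝ => V (toTorus p)) :=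
    V.smooth.continuous_fderiv (by simp)
  obtain ⟨C, hC⟩ := (isCompact_closedBall (0 : ℝ × ℝ) 2).exists_bound_of_continuousOn
    hc.continuousOn
  refine ⟨C.toNNReal, lipschitzWith_of_nnnorm_fderiv_le
    (V.smooth.differentiable (by simp)) fun p => ?_⟩
  have hper : (fun p : ℝ × ℝ => V (toTorus p)) =
      fun x => (fun p : ℝ × ℝ => V (toTorus p)) (x + (p - lift (toTorus p))) := by
    funext x
    simp only [toTorus_add, toTorus_sub_lift, add_zero]
  have h1 : fderiv ℝ (fun p : ℝ × ℝ => V (toTorus p)) p =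
      fderiv ℝ (fun p : ℝ × ℝ => V (toTorus p)) (lift (toTorus p)) := by
    have h2 := fderiv_comp_add_right (𝕜 := ℝ) (f := fun p : ℝ × ℝ => V (toTorus p))
      (x := lift (toTorus p)) (p - lift (toTorus p))
    rw [← hper] at h2
    rw [h2]
    congr 1
    abel
  rw [h1, ← NNReal.coe_le_coe, coe_nnnorm]
  refine (hC _ ?_).trans (Real.le_coe_toNNReal C)
  simpa using norm_lift_le (toTorus p)

lemma integralCurve_unique {c d : ℝ → ℝ × ℝ} (hc : V.IsIntegralCurve c)
    (hd : V.IsIntegralCurve d) (h : c 0 = d 0) : c = d := by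
  obtain ⟨K, hK⟩ := V.exists_lipschitz
  exact ODE_solution_unique_univ (v := fun _ p => V (toTorus p)) (s := fun _ => univ) (K := K)
    (t₀ := 0) (fun _ => hK.lipschitzOnWith) (fun t => ⟨hc t, mem_univ _⟩)
    (fun t => ⟨hd t, mem_univ _⟩) h

lemma exists_integralCurve (p : ℝ × ℝ) : ∃ c, c 0 = p ∧ V.IsIntegralCurve c := by
  obtain ⟨K, hK⟩ := V.exists_lipschitz
  have hloc : ∀ T : ℝ≥0, ∃ c : ℝ → ℝ × ℝ, c 0 = p ∧
      ∀ t ∈ Ioo (-(T : ℝ)) T, HasDerivAt c (V (toTorus (c t))) t := by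
    intro T
    have hpl : IsPicardLindelof (fun _ p => V (toTorus p)) (tmin := -(T : ℝ)) (tmax := T)
        ⟨0, by simp⟩ p T 0 1 K :=
      { lipschitzOnWith := fun _ _ => hK.lipschitzOnWith
        continuousOn := fun _ _ => continuousOn_const
        norm_le := fun _ _ _ _ => V.norm_le_one _
        mul_max_le := by simp }
    obtain ⟨c, hc0, hc⟩ := hpl.exists_eq_forall_mem_Icc_hasDerivWithinAt₀
    exact ⟨c, hc0, fun t ht => (hc t (Ioo_subset_Icc_self ht)).hasDerivAt
      (Icc_mem_nhds ht.1 ht.2)⟩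
  choose γ hγ0 hγ using hloc
  have hagree : ∀ S T : ℝ≥0, S ≤ T → EqOn (γ S) (γ T) (Ioo (-(S : ℝ)) S) := by
    intro S T hST t ht
    have hS : (0 : ℝ) < S := by linarith [ht.1, ht.2]
    have hST' : (S : ℝ) ≤ T := by exact_mod_cast hST
    exact ODE_solution_unique_of_mem_Ioo (v := fun _ p => V (toTorus p)) (s := fun _ => univ)
      (K := K) (t₀ := 0) (fun _ _ => hK.lipschitzOnWith) ⟨by linarith, hS⟩
      (fun t ht => ⟨hγ S t ht, mem_univ _⟩)
      (fun t ht => ⟨hγ T t ⟨by linarith [ht.1], by linarith [ht.2]⟩, mem_univ _⟩)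
      ((hγ0 S).trans (hγ0 T).symm) ht
  refine ⟨fun t => γ (‖t‖₊ + 1) t, hγ0 _, fun t => ?_⟩
  have hev : (fun s => γ (‖s‖₊ + 1) s) =ᶠ[𝓝 t] γ (‖t‖₊ + 2) := by
    have hcont : ∀ᶠ s in 𝓝 t, |s| < |t| + 1 :=
      (continuous_abs.tendsto t).eventually (gt_mem_nhds (by linarith))
    filter_upwards [hcont] with s hs
    refine hagree _ _ ?_ ?_
    · rw [← NNReal.coe_le_coe]
      push_cast
      rw [Real.norm_eq_abs, Real.norm_eq_abs]
      linarith
    · push_cast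
      rw [Real.norm_eq_abs, mem_Ioo, ← abs_lt]
      linarith
  have ht : t ∈ Ioo (-(((‖t‖₊ + 2 : ℝ≥0)) : ℝ)) ((‖t‖₊ + 2 : ℝ≥0) : ℝ) := by
    push_cast
    rw [Real.norm_eq_abs, mem_Ioo, ← abs_lt]
    linarith
  have h := (hγ _ t ht).congr_of_eventuallyEq hev
  rwa [← hev.eq_of_nhds] at h

/-- The integral curve of `V` in the plane that starts at `p`. -/
def planeFlow (p : ℝ × ℝ) : ℝ → ℝ × ℝ := (V.exists_integralCurve p).choose

lemma planeFlow_zero (p : ℝ × ℝ) : V.planeFlow p 0 = p :=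
  (V.exists_integralCurve p).choose_spec.1

lemma isIntegralCurve_planeFlow (p : ℝ × ℝ) : V.IsIntegralCurve (V.planeFlow p) :=
  (V.exists_integralCurve p).choose_spec.2

/-- The flow of `V` on the torus. Since `V` has length one, `t` is the signed arc length from `q`
along the integral curve through `q`. -/
def flow (q : Torus) (t : ℝ) : Torus := toTorus (V.planeFlow (lift q) t)

/-- The flow does not depend on the lift: every integral curve through `q` projects to it. -/
lemma flow_eq {c : ℝ → ℝ × ℝ} (hc : V.IsIntegralCurve c) (t : ℝ) :
    V.flow (toTorus (c 0)) t = toTorus (c t) := by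
  set h : ℝ × ℝ := c 0 - lift (toTorus (c 0)) with hh
  have h0 : toTorus h = 0 := toTorus_sub_lift (c 0)
  have hd : V.IsIntegralCurve fun t => V.planeFlow (lift (toTorus (c 0))) t + h := by
    intro s
    simp only [toTorus_add, h0, add_zero]
    exact (V.isIntegralCurve_planeFlow _ s).add_const h
  have := V.integralCurve_unique hc hd (by simp [planeFlow_zero, hh])
  rw [congrFun this t, toTorus_add, h0, add_zero, flow]

lemma dist_planeFlow_le : ∃ K : ℝ≥0, ∀ p p' t,
    dist (V.planeFlow p t) (V.planeFlow p' t) ≤ dist p p' * Real.exp (K * |t|) := by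
  obtain ⟨K, hK⟩ := V.exists_lipschitz
  have hKn : LipschitzWith K fun p : ℝ × ℝ => -V (toTorus p) := hK.neg
  refine ⟨K, fun p p' t => ?_⟩
  have hP := V.isIntegralCurve_planeFlow
  have hcont : ∀ p, Continuous (V.planeFlow p) := fun p =>
    continuous_iff_continuousAt.2 fun t => (hP p t).continuousAt
  rcases le_total 0 t with ht | ht
  · have := dist_le_of_trajectories_ODE (v := fun _ p => V (toTorus p)) (a := 0) (b := t)
      (fun _ => hK) (hcont p).continuousOn (fun s _ => (hP p s).hasDerivWithinAt)
      (hcont p').continuousOn (fun s _ => (hP p' s).hasDerivWithinAt) le_rfl t ⟨ht, le_rfl⟩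
    simpa [planeFlow_zero, abs_of_nonneg ht] using this
  · have hneg : ∀ p s, HasDerivAt (fun s => V.planeFlow p (-s))
        (-V (toTorus (V.planeFlow p (-s)))) s := by
      intro p s
      have := (hP p (-s)).scomp s (hasDerivAt_neg s)
      rw [neg_one_smul] at this
      exact this
    have := dist_le_of_trajectories_ODE (v := fun _ p => -V (toTorus p)) (a := 0) (b := -t)
      (f := fun s => V.planeFlow p (-s)) (g := fun s => V.planeFlow p' (-s))
      (fun _ => hKn) ((hcont p).comp continuous_neg).continuousOn
      (fun s _ => (hneg p s).hasDerivWithinAt)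
      ((hcont p').comp continuous_neg).continuousOn
      (fun s _ => (hneg p' s).hasDerivWithinAt) le_rfl (-t) ⟨by linarith, le_rfl⟩
    simpa [planeFlow_zero, abs_of_nonpos ht] using this

lemma continuous_planeFlow : Continuous fun z : (ℝ × ℝ) × ℝ => V.planeFlow z.1 z.2 := by
  obtain ⟨K, hK⟩ := V.dist_planeFlow_le
  refine continuous_iff_continuousAt.2 fun z => ?_
  have h2 : Tendsto (fun w : (ℝ × ℝ) × ℝ => dist w.1 z.1 * Real.exp (K * |w.2|) +
      dist (V.planeFlow z.1 w.2) (V.planeFlow z.1 z.2)) (𝓝 z) (𝓝 0) := by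
    have hc : Continuous (V.planeFlow z.1) :=
      continuous_iff_continuousAt.2 fun t => (V.isIntegralCurve_planeFlow z.1 t).continuousAt
    have : Continuous fun w : (ℝ × ℝ) × ℝ => dist w.1 z.1 * Real.exp (K * |w.2|) +
      dist (V.planeFlow z.1 w.2) (V.planeFlow z.1 z.2) := by fun_prop
    simpa using this.tendsto z
  refine tendsto_iff_dist_tendsto_zero.2 (squeeze_zero (fun _ => dist_nonneg) (fun w => ?_) h2)
  exact (dist_triangle _ (V.planeFlow z.1 w.2) _).trans (by gcongr; exact hK _ _ _)

lemma measurable_flow : Measurable fun z : Torus × ℝ => V.flow z.1 z.2 :=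
  continuous_toTorus.measurable.comp (V.continuous_planeFlow.measurable.comp
    ((measurable_lift.comp measurable_fst).prodMk measurable_snd))

end UnitVectorField

lemma measurable_catMap : Measurable catMap := by
  have : Continuous catMap := by unfold catMap; fun_prop
  exact this.measurable

/-! ### The random perturbation -/

/-- The uniform distribution on `[-1, 1]`. -/
def unif : Measure ℝ := volume[|Icc (-1 : ℝ) 1]

instance : IsProbabilityMeasure unif :=
  cond_isProbabilityMeasure_of_finite (by simp) (by simp)

/-- `arcKernel V ε q` is the distribution `Q_q`: the law of the point at signed arc length `ε u`
from `q` along the integral curve of `V` through `q`, where `u` is uniform on `[-1, 1]`. For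
`0 < ε` this is the uniform distribution on the arc of points at distance at most `ε` from `q`
along this curve. -/
def arcKernel (V : UnitVectorField) (ε : ℝ) : Kernel Torus Torus where
  toFun q := unif.map fun u => V.flow q (ε * u)
  measurable' := by
    have h : Measurable fun z : Torus × ℝ => V.flow z.1 (ε * z.2) :=
      V.measurable_flow.comp (measurable_fst.prodMk (measurable_snd.const_mul ε))
    have h' : (fun q => unif.map fun u => V.flow q (ε * u)) =
        fun q => (unif.map (Prod.mk q)).map fun z : Torus × ℝ => V.flow z.1 (ε * z.2) := by
      funext q
      rw [Measure.map_map h measurable_prodMk_left]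
      rfl
    rw [h']
    exact (Measure.measurable_map _ h).comp Measurable.map_prodMk_left

instance (V : UnitVectorField) (ε : ℝ) : IsMarkovKernel (arcKernel V ε) :=
  ⟨fun _ => Measure.isProbabilityMeasure_map
    (V.measurable_flow.comp (measurable_const.prodMk (measurable_id.const_mul ε))).aemeasurable⟩

/-- The transition probabilities `P(A | q) = Q_{f q}(A)` of the random perturbation of the
Cat Map `f` along `V`. -/
def transition (V : UnitVectorField) (ε : ℝ) : Kernel Torus Torus :=
  (arcKernel V ε).comap catMap measurable_catMap

instance (V : UnitVectorField) (ε : ℝ) : IsMarkovKernel (transition V ε) := by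
  unfold transition; infer_instance

/-- The action `ν ↦ ℱ_* ν = ∫ P(· | q) dν(q)` of the perturbed dynamics on Borel probability
measures. -/
def push (V : UnitVectorField) (ε : ℝ) (ν : ProbabilityMeasure Torus) : ProbabilityMeasure Torus :=
  ⟨(ν : Measure Torus).bind (transition V ε), inferInstance⟩

/-- The Cesàro average `(1 / n) ∑_{i < n} ℱ_*^i ν`. -/
def cesaro (V : UnitVectorField) (ε : ℝ) (ν : ProbabilityMeasure Torus) (n : ℕ) :
    FiniteMeasure Torus :=
  (n : ℝ≥0)⁻¹ • ∑ i ∈ Finset.range n, ((push V ε)^[i] ν).toFiniteMeasure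

/-! ### The neighborhoods of the fixed point -/

/-- The Gaussian-shaped curve of level `K`, as a function of `x`. -/
def gauss (σ K x : ℝ) : ℝ := K * Real.exp (-x ^ 2 / (2 * σ ^ 2))

/-- The open region of the plane bounded by the lines `x = ± a` and by the curves
`y = ± b exp (-x² / 2σ²)`. -/
def gaussRegion (σ a b : ℝ) : Set (ℝ × ℝ) := {p | |p.1| < a ∧ |p.2| < gauss σ b p.1}

/-- The segment `[-a, a] × {0}` of the local stable manifold of the fixed point. -/
def stableSegment (a : ℝ) : Set Torus := toTorus '' (Icc (-a) a ×ˢ {0})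

end CatMap

end

noncomputable section

namespace CatMap

section

/-! ### Continuity of the flow -/

/-! Inside `W` the noise moves a point along its own Gaussian curve `y = K exp (-x² / 2σ²)`, so it
does not change the level `K`. The map `(x, y) ↦ (μ x, λ y)` multiplies the level by `λ exp (-(1 -
μ²) x² / 2σ²)`. This factor is at most `λ`, and at most `1 / λ` once `|x| ≥ σ √(4 log λ / (1 -
μ²))`. By (B1), a random point of the arc misses this last condition with probability at most `1/3`.

The mean of the factor itself need not be below `1`, but the mean of its square root is: since `√λ =
1 + τ` and `1 / √λ = τ`, it is at most `τ + 1/3 < 1`. Hence the square root of the level of the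
image, cut off at `1` and set to `1` outside `W` (`potential`), contracts in the mean wherever it is
below `1` (`step_potential_le`).

Where the potential equals `1`, it suffices that the chain can reach the stable segment with
positive probability (`exists_reach_segment`). An arc with some extent in the unstable direction is
stretched by the Cat Map until an iterate crosses a lift of the segment. An arc inside a stable line
must lie in `U'`, because `cos φ ≠ 0`, and the shape of the field in `W` forces it through the fixed
point. Compactness makes the gain uniform, so the mean potential decays to `0` uniformly in the
starting point (`exists_forall_iterate_step_potential_le`).

On the segment the chain is `x ↦ μ x + ε u` with `u` uniform, an affine contraction with common
noise. Iterates of the Markov operator therefore flatten every continuous function there, to its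
mean under a single measure `m` (`exists_limit_measure`). Together the two facts give `ℱ_*ⁿ ν → m`
for every `ν` (`tendsto_integral_iterate_push`), which yields uniqueness, the limit points and the
Cesàro averages at once. -/

lemma isOpenMap_toTorus : IsOpenMap toTorus := by
  have hs : √(1 + tau ^ 2) ≠ 0 := (Real.sqrt_pos.2 one_add_tau_sq_pos).ne'
  have hq : √(1 + tau ^ 2) * √(1 + tau ^ 2) = 1 + tau ^ 2 :=
    Real.mul_self_sqrt one_add_tau_sq_pos.le
  -- The matrix of the frame is symmetric and orthogonal, a reflection, hence its own inverse.
  let e : ℝ × ℝ ≃ₜ ℝ × ℝ :=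
    { toFun p := ((-tau * p.1 + p.2) / √(1 + tau ^ 2), (p.1 + tau * p.2) / √(1 + tau ^ 2))
      invFun p := ((-tau * p.1 + p.2) / √(1 + tau ^ 2), (p.1 + tau * p.2) / √(1 + tau ^ 2))
      left_inv p := by
        ext <;> field_simp <;> rw [sq, hq] <;> ring
      right_inv p := by
        ext <;> field_simp <;> rw [sq, hq] <;> ring
      continuous_toFun := by fun_prop
      continuous_invFun := by fun_prop }
  have h1 : IsOpenMap ((↑) : ℝ → UnitAddCircle) := QuotientAddGroup.isOpenMap_coe
  exact (h1.prodMap h1).comp e.isOpenMap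

lemma toTorus_surjective : Function.Surjective toTorus := fun q => ⟨lift q, toTorus_lift q⟩

namespace UnitVectorField

variable (V : UnitVectorField)

lemma flow_toTorus (p : ℝ × ℝ) (t : ℝ) : V.flow (toTorus p) t = toTorus (V.planeFlow p t) := by
  simpa [planeFlow_zero] using V.flow_eq (V.isIntegralCurve_planeFlow p) t

/-- `lift` is discontinuous, so continuity is not visible from the definition of `flow`. It descends
from the plane because the covering is an open quotient map. -/
lemma continuous_flow : Continuous fun z : Torus × ℝ => V.flow z.1 z.2 := by
  have hq : IsOpenQuotientMap (Prod.map toTorus (id : ℝ → ℝ)) :=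
    ⟨toTorus_surjective.prodMap Function.surjective_id,
      continuous_toTorus.prodMap continuous_id, isOpenMap_toTorus.prodMap IsOpenMap.id⟩
  rw [← hq.isQuotientMap.continuous_iff.symm]
  have : ((fun z : Torus × ℝ => V.flow z.1 z.2) ∘ Prod.map toTorus id) =
      fun z : (ℝ × ℝ) × ℝ => toTorus (V.planeFlow z.1 z.2) := by
    funext z
    simp [flow_toTorus]
  rw [this]
  exact continuous_toTorus.comp V.continuous_planeFlow

attribute [local irreducible] flow in
lemma continuous_flow_comp {X : Type*} [TopologicalSpace X] {f : X → Torus} {t : X → ℝ}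
    (hf : Continuous f) (ht : Continuous t) : Continuous fun x => V.flow (f x) (t x) :=
  V.continuous_flow.comp (hf.prodMk ht)

end UnitVectorField

lemma continuous_catMap : Continuous catMap := by unfold catMap; fun_prop

/-! ### The uniform distribution on `[-1, 1]` -/

lemma ae_unif_mem : ∀ᵐ u ∂unif, u ∈ Icc (-1 : ℝ) 1 :=
  ae_cond_mem measurableSet_Icc

lemma unif_eq : unif = (2 : ENNReal)⁻¹ • volume.restrict (Icc (-1 : ℝ) 1) := by
  rw [unif, ProbabilityTheory.cond, Real.volume_Icc]
  norm_num

lemma integral_unif (h : ℝ → ℝ) : ∫ u, h u ∂unif = 2⁻¹ * ∫ u in (-1)..1, h u := by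
  rw [unif_eq, integral_smul_measure, intervalIntegral.integral_of_le (by norm_num),
    integral_Icc_eq_integral_Ioc]
  simp

lemma integral_unif_neg (h : ℝ → ℝ) : ∫ u, h (-u) ∂unif = ∫ u, h u ∂unif := by
  rw [integral_unif, integral_unif, intervalIntegral.integral_comp_neg]
  simp

/-- A nonnegative continuous function has a positive mean if it is positive at a point of
`[-1, 1]`. -/
lemma integral_unif_pos {h : ℝ → ℝ} (hc : Continuous h) (h0 : ∀ u, 0 ≤ h u) {u : ℝ}
    (hu : u ∈ Icc (-1 : ℝ) 1) (hpos : 0 < h u) : 0 < ∫ u, h u ∂unif := by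
  rw [integral_unif]
  have := intervalIntegral.integral_pos (by norm_num) hc.continuousOn (fun x _ => h0 x)
    ⟨u, hu, hpos⟩
  positivity

/-! ### The Markov operator -/

/-- The Markov operator on functions that is dual to `push`. -/
def step (V : UnitVectorField) (ε : ℝ) (h : Torus → ℝ) (q : Torus) : ℝ :=
  ∫ u, h (V.flow (catMap q) (ε * u)) ∂unif

section step

variable (V : UnitVectorField) (ε : ℝ)

lemma continuous_flow_catMap :
    Continuous fun z : Torus × ℝ => V.flow (catMap z.1) (ε * z.2) :=
  V.continuous_flow_comp (continuous_catMap.comp continuous_fst) (continuous_snd.const_mul ε)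

lemma continuous_flow_catMap_right (q : Torus) :
    Continuous fun u : ℝ => V.flow (catMap q) (ε * u) :=
  V.continuous_flow_comp continuous_const (continuous_id.const_mul ε)

lemma continuous_flow_catMap_left (u : ℝ) :
    Continuous fun q : Torus => V.flow (catMap q) (ε * u) :=
  V.continuous_flow_comp continuous_catMap continuous_const

variable {h k : Torus → ℝ} {C : ℝ}

lemma integrable_of_bound {α : Type*} [MeasurableSpace α] {P : Measure α} [IsFiniteMeasure P]
    {h : α → ℝ} (hm : Measurable h) (hC : ∀ q, |h q| ≤ C) : Integrable h P :=
  Integrable.of_bound hm.aestronglyMeasurable C (Eventually.of_forall hC)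

lemma integrable_step (hm : Measurable h) (hC : ∀ q, |h q| ≤ C) (q : Torus) :
    Integrable (fun u => h (V.flow (catMap q) (ε * u))) unif :=
  integrable_of_bound (hm.comp (continuous_flow_catMap_right V ε q).measurable) fun _ => hC _

lemma measurable_step (hm : Measurable h) : Measurable (step V ε h) := by
  have : StronglyMeasurable fun z : Torus × ℝ => h (V.flow (catMap z.1) (ε * z.2)) :=
    (hm.comp (continuous_flow_catMap V ε).measurable).stronglyMeasurable
  exact (this.integral_prod_right (ν := unif)).measurable

lemma abs_step_le (hC : ∀ q, |h q| ≤ C) (q : Torus) : |step V ε h q| ≤ C := by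
  have := norm_integral_le_of_norm_le_const (μ := unif)
    (f := fun u => h (V.flow (catMap q) (ε * u))) (Eventually.of_forall fun u => hC _)
  simpa [step] using this

lemma continuous_step (hc : Continuous h) : Continuous (step V ε h) := by
  obtain ⟨C, hC⟩ := isCompact_univ.exists_bound_of_continuousOn hc.continuousOn
  refine continuous_of_dominated (bound := fun _ => C) (fun q => ?_)
    (fun q => Eventually.of_forall fun u => hC _ (mem_univ _)) (integrable_const C)
    (Eventually.of_forall fun u => ?_)
  · exact (hc.comp (continuous_flow_catMap_right V ε q)).measurable.aestronglyMeasurable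
  · exact hc.comp (continuous_flow_catMap_left V ε u)

lemma step_mono {D : ℝ} (hm : Measurable h) (hC : ∀ q, |h q| ≤ C) (km : Measurable k)
    (kC : ∀ q, |k q| ≤ D) (hk : ∀ q, h q ≤ k q) (q : Torus) : step V ε h q ≤ step V ε k q :=
  integral_mono (integrable_step V ε hm hC q) (integrable_step V ε km kC q) fun _ => hk _

lemma step_const_mul (c : ℝ) : step V ε (fun q => c * h q) = fun q => c * step V ε h q :=
  funext fun _ => integral_const_mul _ _

lemma step_const_sub (c : ℝ) (hm : Measurable h) (hC : ∀ q, |h q| ≤ C) :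
    step V ε (fun q => c - h q) = fun q => c - step V ε h q := by
  funext q
  rw [step, integral_sub (integrable_const c) (integrable_step V ε hm hC q)]
  simp [step]

/-- The duality that turns every statement on `push` into one on functions. -/
lemma integral_push (hm : Measurable h) (hC : ∀ q, |h q| ≤ C) (ν : ProbabilityMeasure Torus) :
    ∫ q, h q ∂(push V ε ν : Measure Torus) = ∫ q, step V ε h q ∂(ν : Measure Torus) := by
  have hb : (push V ε ν : Measure Torus) =
      (transition V ε ∘ₖ Kernel.const Unit (ν : Measure Torus)) () := by
    rw [Kernel.comp_apply, Kernel.const_apply]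
    rfl
  have hi : Integrable h (push V ε ν : Measure Torus) := integrable_of_bound hm hC
  rw [hb] at hi ⊢
  rw [Kernel.integral_comp hi, Kernel.const_apply]
  refine integral_congr_ae (Eventually.of_forall fun q => ?_)
  exact integral_map (continuous_flow_catMap_right V ε q).measurable.aemeasurable
    hm.aestronglyMeasurable

lemma measurable_iterate_step (hm : Measurable h) (n : ℕ) : Measurable ((step V ε)^[n] h) := by
  induction n with
  | zero => exact hm
  | succ n ih => rw [Function.iterate_succ_apply']; exact measurable_step V ε ih

lemma continuous_iterate_step (hc : Continuous h) (n : ℕ) : Continuous ((step V ε)^[n] h) := by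
  induction n with
  | zero => exact hc
  | succ n ih => rw [Function.iterate_succ_apply']; exact continuous_step V ε ih

lemma abs_iterate_step_le (hC : ∀ q, |h q| ≤ C) (n : ℕ) (q : Torus) :
    |(step V ε)^[n] h q| ≤ C := by
  induction n generalizing q with
  | zero => exact hC q
  | succ n ih => rw [Function.iterate_succ_apply']; exact abs_step_le V ε ih q

lemma iterate_step_mono {D : ℝ} (hm : Measurable h) (hC : ∀ q, |h q| ≤ C) (km : Measurable k)
    (kC : ∀ q, |k q| ≤ D) (hk : ∀ q, h q ≤ k q) (n : ℕ) (q : Torus) :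
    (step V ε)^[n] h q ≤ (step V ε)^[n] k q := by
  induction n generalizing q with
  | zero => exact hk q
  | succ n ih =>
    rw [Function.iterate_succ_apply', Function.iterate_succ_apply']
    exact step_mono V ε (measurable_iterate_step V ε hm n) (abs_iterate_step_le V ε hC n)
      (measurable_iterate_step V ε km n) (abs_iterate_step_le V ε kC n) ih q

lemma iterate_step_const_mul (c : ℝ) (n : ℕ) :
    (step V ε)^[n] (fun q => c * h q) = fun q => c * (step V ε)^[n] h q := by
  induction n with
  | zero => rfl
  | succ n ih => rw [Function.iterate_succ_apply', ih, step_const_mul, Function.iterate_succ_apply']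

lemma iterate_step_const_sub (c : ℝ) (hm : Measurable h) (hC : ∀ q, |h q| ≤ C) (n : ℕ) :
    (step V ε)^[n] (fun q => c - h q) = fun q => c - (step V ε)^[n] h q := by
  induction n with
  | zero => rfl
  | succ n ih =>
    rw [Function.iterate_succ_apply', ih, step_const_sub V ε c (measurable_iterate_step V ε hm n)
      (abs_iterate_step_le V ε hC n), Function.iterate_succ_apply']

lemma integral_iterate_push (hm : Measurable h) (hC : ∀ q, |h q| ≤ C)
    (ν : ProbabilityMeasure Torus) (n : ℕ) :
    ∫ q, h q ∂((push V ε)^[n] ν : Measure Torus) =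
      ∫ q, (step V ε)^[n] h q ∂(ν : Measure Torus) := by
  induction n generalizing ν with
  | zero => rfl
  | succ n ih =>
    rw [Function.iterate_succ_apply, ih,
      integral_push V ε (measurable_iterate_step V ε hm n) (abs_iterate_step_le V ε hC n),
      Function.iterate_succ_apply']

lemma step_pos (hc : Continuous h) (h0 : ∀ q, 0 ≤ h q) {q : Torus} {u : ℝ}
    (hu : u ∈ Icc (-1 : ℝ) 1) (hpos : 0 < h (V.flow (catMap q) (ε * u))) : 0 < step V ε h q :=
  integral_unif_pos (hc.comp (continuous_flow_catMap_right V ε q)) (fun _ => h0 _) hu hpos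

lemma step_nonneg (h0 : ∀ q, 0 ≤ h q) (q : Torus) : 0 ≤ step V ε h q :=
  integral_nonneg fun _ => h0 _

end step

end

section

/-! ### The eigenvalues -/

lemma sqrt_five_sq : √5 * √5 = (5 : ℝ) := Real.mul_self_sqrt (by norm_num)

lemma tau_sq : tau ^ 2 = 1 - tau := by
  unfold tau
  linarith [sqrt_five_sq, show ((√5 - 1) / 2) ^ 2 = (√5 * √5 - 2 * √5 + 1) / 4 by ring]

lemma tau_bounds : 0.618 < tau ∧ tau < 0.619 := by
  unfold tau
  constructor
  · have : (2.236 : ℝ) < √5 := Real.lt_sqrt_of_sq_lt (by norm_num)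
    linarith
  · have : √5 < (2.238 : ℝ) := (Real.sqrt_lt' (by norm_num)).2 (by norm_num)
    linarith

lemma mu_eq : mu = 1 - tau := by unfold mu tau; ring

lemma lam_eq : lam = 2 + tau := by unfold lam tau; ring

lemma mu_pos : 0 < mu := by rw [mu_eq]; linarith [tau_bounds.2]

lemma mu_lt_one : mu < 1 := by rw [mu_eq]; linarith [tau_bounds.1]

lemma one_lt_lam : 1 < lam := by rw [lam_eq]; linarith [tau_bounds.1]

lemma mu_mul_lam : mu * lam = 1 := by
  rw [mu_eq, lam_eq]
  linarith [tau_sq, show (1 - tau) * (2 + tau) = 2 - tau - tau ^ 2 by ring]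

lemma sqrt_lam : √lam = 1 + tau := by
  rw [lam_eq, Real.sqrt_eq_iff_mul_self_eq (by linarith [tau_bounds.1])
    (by linarith [tau_bounds.1])]
  linarith [tau_sq, show (1 + tau) * (1 + tau) = 1 + 2 * tau + tau ^ 2 by ring]

lemma catMap_toTorus (p : ℝ × ℝ) : catMap (toTorus p) = toTorus (mu * p.1, lam * p.2) := by
  unfold catMap toTorus
  ext
  · simp only [two_nsmul, ← AddCircle.coe_add]
    congr 1
    rw [mu_eq, lam_eq]
    field_simp
    linear_combination (-p.1) * tau_sq
  · simp only [← AddCircle.coe_add]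
    congr 1
    rw [mu_eq, lam_eq]
    field_simp
    linear_combination (-p.2) * tau_sq

/-! ### The Gaussian curves -/

/-- The Gaussian profile `exp (-x² / 2σ²)`. -/
def bell (σ x : ℝ) : ℝ := Real.exp (-x ^ 2 / (2 * σ ^ 2))

variable {σ : ℝ}

lemma gauss_eq (K x : ℝ) : gauss σ K x = K * bell σ x := rfl

lemma bell_pos (x : ℝ) : 0 < bell σ x := Real.exp_pos _

lemma bell_le_one (x : ℝ) : bell σ x ≤ 1 :=
  Real.exp_le_one_iff.2 (div_nonpos_of_nonpos_of_nonneg (by nlinarith) (by positivity))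

lemma bell_zero : bell σ 0 = 1 := by simp [bell]

lemma continuous_bell : Continuous (bell σ) := by unfold bell; fun_prop

lemma hasDerivAt_bell (x : ℝ) : HasDerivAt (bell σ) (-(x / σ ^ 2) * bell σ x) x := by
  have h : HasDerivAt (fun x : ℝ => -x ^ 2 / (2 * σ ^ 2)) (-(2 * x) / (2 * σ ^ 2)) x := by
    simpa using ((hasDerivAt_pow 2 x).neg).div_const (2 * σ ^ 2)
  refine h.exp.congr_deriv ?_
  rw [mul_comm, neg_div, mul_div_mul_left _ _ two_ne_zero, bell]

/-- The signed variation of the Gaussian profile between `0` and `x`. -/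
def climb (σ x : ℝ) : ℝ := if 0 ≤ x then 1 - bell σ x else bell σ x - 1

lemma abs_climb_le (x : ℝ) : |climb σ x| ≤ 1 := by
  have h0 := bell_pos (σ := σ) x
  have h1 := bell_le_one (σ := σ) x
  unfold climb
  split_ifs <;> rw [abs_le] <;> constructor <;> linarith

lemma hasDerivAt_climb (x : ℝ) : HasDerivAt (climb σ) (|x| / σ ^ 2 * bell σ x) x := by
  have hp : HasDerivAt (fun x => 1 - bell σ x) (x / σ ^ 2 * bell σ x) x := by
    simpa using (hasDerivAt_bell (σ := σ) x).const_sub 1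
  have hn : HasDerivAt (fun x => bell σ x - 1) (-(x / σ ^ 2) * bell σ x) x :=
    (hasDerivAt_bell (σ := σ) x).sub_const 1
  rcases lt_trichotomy x 0 with hx | rfl | hx
  · rw [abs_of_neg hx, neg_div]
    refine hn.congr_of_eventuallyEq ?_
    filter_upwards [gt_mem_nhds hx] with z hz
    simp [climb, not_le.2 hz]
  -- The two branches glue at the origin because both have derivative `0` there.
  · simp only [zero_div, zero_mul, neg_zero, abs_zero] at hp hn ⊢
    rw [← hasDerivWithinAt_univ, ← Iic_union_Ici (a := (0 : ℝ))]
    refine HasDerivWithinAt.union (hn.hasDerivWithinAt.congr (fun z hz => ?_) ?_)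
      (hp.hasDerivWithinAt.congr (fun z hz => ?_) ?_)
    · rcases eq_or_lt_of_le (mem_Iic.1 hz) with rfl | hz
      · simp [climb, bell_zero]
      · simp [climb, not_le.2 hz]
    · simp [climb, bell_zero]
    · simp [climb, mem_Ici.1 hz]
    · simp [climb]
  · rw [abs_of_pos hx]
    refine hp.congr_of_eventuallyEq ?_
    filter_upwards [lt_mem_nhds hx] with z hz
    simp [climb, hz.le]

/-! ### Integral curves near the stable segment -/

variable {V : UnitVectorField} {a b : ℝ}

/-- In the region `|x| < a`, `|y| < b exp (-x² / 2σ²)`, the field is tangent to the curves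
`y = K exp (-x² / 2σ²)`. -/
def IsTangent (V : UnitVectorField) (σ a b : ℝ) : Prop :=
  ∀ K x : ℝ, (x, gauss σ K x) ∈ gaussRegion σ a b →
    ∃ c : ℝ, V (toTorus (x, gauss σ K x)) = c • ((1 : ℝ), deriv (gauss σ K) x)

lemma mem_gaussRegion {p : ℝ × ℝ} :
    p ∈ gaussRegion σ a b ↔ |p.1| < a ∧ |p.2| < b * bell σ p.1 := Iff.rfl

lemma isOpen_gaussRegion : IsOpen (gaussRegion σ a b) := by
  have h : gaussRegion σ a b = {p | |p.1| < a} ∩ {p | |p.2| < b * bell σ p.1} := rfl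
  rw [h]
  have := continuous_bell (σ := σ)
  exact (isOpen_lt (by fun_prop) (by fun_prop)).inter (isOpen_lt (by fun_prop) (by fun_prop))

/-- The Gaussian curves are the solutions of `dy/dx = -x y / σ²`; this form of tangency no longer
mentions `K`. -/
lemma IsTangent.snd_eq (hV : IsTangent V σ a b) {p : ℝ × ℝ} (hp : p ∈ gaussRegion σ a b) :
    (V (toTorus p)).2 = -(p.1 * p.2 / σ ^ 2) * (V (toTorus p)).1 := by
  have hb : bell σ p.1 ≠ 0 := (bell_pos p.1).ne'
  have hpe : p = (p.1, gauss σ (p.2 / bell σ p.1) p.1) := by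
    rw [gauss_eq, div_mul_cancel₀ _ hb]
  obtain ⟨c, hc⟩ := hV (p.2 / bell σ p.1) p.1 (hpe ▸ hp)
  rw [← hpe] at hc
  have hd : deriv (gauss σ (p.2 / bell σ p.1)) p.1 =
      p.2 / bell σ p.1 * (-(p.1 / σ ^ 2) * bell σ p.1) :=
    ((hasDerivAt_bell p.1).const_mul _).deriv
  rw [hc, hd]
  simp only [Prod.smul_fst, Prod.smul_snd, smul_eq_mul]
  field_simp

namespace UnitVectorField

variable (V) (p : ℝ × ℝ)

lemma hasDerivAt_fst (t : ℝ) :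
    HasDerivAt (fun t => (V.planeFlow p t).1) (V (toTorus (V.planeFlow p t))).1 t :=
  (ContinuousLinearMap.fst ℝ ℝ ℝ).hasFDerivAt.comp_hasDerivAt t (V.isIntegralCurve_planeFlow p t)

lemma hasDerivAt_snd (t : ℝ) :
    HasDerivAt (fun t => (V.planeFlow p t).2) (V (toTorus (V.planeFlow p t))).2 t :=
  (ContinuousLinearMap.snd ℝ ℝ ℝ).hasFDerivAt.comp_hasDerivAt t (V.isIntegralCurve_planeFlow p t)

lemma continuous_planeFlow_right : Continuous (V.planeFlow p) :=
  continuous_iff_continuousAt.2 fun t => (V.isIntegralCurve_planeFlow p t).continuousAt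

lemma abs_fst_sub_le (s t : ℝ) :
    |(V.planeFlow p t).1 - (V.planeFlow p s).1| ≤ |t - s| := by
  have := Convex.norm_image_sub_le_of_norm_hasDerivWithin_le (C := 1)
    (fun t _ => (V.hasDerivAt_fst p t).hasDerivWithinAt)
    (fun t _ => (norm_fst_le _).trans (V.norm_le_one _)) convex_univ (mem_univ s) (mem_univ t)
  simpa using this

end UnitVectorField

section curve

variable {p : ℝ × ℝ} {ε : ℝ}

/-- An integral curve that starts in the region at distance more than `ε` from its sides
follows a Gaussian curve up to time `ε`. -/
lemma IsTangent.planeFlow_eq (hV : IsTangent V σ a b) (hσ : σ ≠ 0) (hp : p ∈ gaussRegion σ a b)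
    (hpε : |p.1| + ε < a) {t : ℝ} (ht : t ∈ Icc (-ε) ε) :
    V.planeFlow p t ∈ gaussRegion σ a b ∧
      (V.planeFlow p t).2 = p.2 / bell σ p.1 * bell σ (V.planeFlow p t).1 := by
  -- A slightly longer open time interval makes the endpoints `± ε` interior points.
  obtain ⟨ε', hε', hpε'⟩ := exists_between hpε
  obtain ⟨δ, rfl⟩ : ∃ δ, ε' = |p.1| + δ := ⟨ε' - |p.1|, by ring⟩
  have hεδ : ε < δ := by linarith
  set J := Ioo (-δ) δ
  set c := V.planeFlow p with hc
  set k : ℝ → ℝ := fun t => (c t).2 / bell σ (c t).1 with hk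
  have hcc : Continuous c := V.continuous_planeFlow_right p
  have hkc : Continuous k := by
    have := continuous_bell (σ := σ)
    exact (by fun_prop : Continuous fun t => (c t).2).div (by fun_prop) fun t => (bell_pos _).ne'
  have hx : ∀ t ∈ J, |(c t).1| < a := by
    intro t ht
    have h := V.abs_fst_sub_le p 0 t
    rw [V.planeFlow_zero, sub_zero] at h
    have h1 : |t| < δ := abs_lt.2 ht
    calc |(c t).1| = |((c t).1 - p.1) + p.1| := by ring_nf
      _ ≤ |(c t).1 - p.1| + |p.1| := abs_add_le _ _
      _ < a := by linarith
  have hmem : ∀ t ∈ J, |k t| < b → c t ∈ gaussRegion σ a b := by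
    intro t ht hb
    refine ⟨hx t ht, ?_⟩
    rwa [hk, abs_div, abs_of_pos (bell_pos _), div_lt_iff₀ (bell_pos _)] at hb
  have hder : ∀ t ∈ J, |k t| < b → HasDerivAt k 0 t := by
    intro t ht hb
    have h1 := V.hasDerivAt_snd p t
    have h2 := (hasDerivAt_bell (σ := σ) (c t).1).comp t (V.hasDerivAt_fst p t)
    have h3 := h1.div h2 (bell_pos _).ne'
    have hb' := (bell_pos (σ := σ) (c t).1).ne'
    have h4 : ((V (toTorus (c t))).2 * bell σ (c t).1 - (c t).2 *
        (-((c t).1 / σ ^ 2) * bell σ (c t).1 * (V (toTorus (c t))).1)) / bell σ (c t).1 ^ 2 = 0 := by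
      rw [hV.snd_eq (hmem t ht hb)]
      field_simp
      ring
    rw [← h4]
    exact h3
  have h0 : k 0 = p.2 / bell σ p.1 := by simp [hk, hc, V.planeFlow_zero]
  have hk0 : |k 0| < b := by
    rw [h0, abs_div, abs_of_pos (bell_pos _), div_lt_iff₀ (bell_pos _)]
    exact hp.2
  -- The level `k` has derivative zero only as long as the curve is known to stay in the region,
  -- which itself depends on `k`. Connectedness of `J` breaks the circle: the set `k = k 0` is open
  -- in `J` by the local computation and closed by continuity.
  have hconst : ∀ t ∈ J, k t = k 0 := by
    have hu : IsOpen (J ∩ {t | k t = k 0}) := by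
      rw [Metric.isOpen_iff]
      rintro s ⟨hs, hks⟩
      have hO : IsOpen (J ∩ {t | |k t| < b}) := isOpen_Ioo.inter (isOpen_lt hkc.abs continuous_const)
      obtain ⟨δ, hδ, hball⟩ := Metric.isOpen_iff.1 hO s ⟨hs, by rw [mem_ofPred_eq, hks]; exact hk0⟩
      refine ⟨δ, hδ, fun r hr => ⟨(hball hr).1, ?_⟩⟩
      have := (convex_ball s δ).norm_image_sub_le_of_norm_hasDerivWithin_le (C := 0)
        (fun r hr => (hder r (hball hr).1 (hball hr).2).hasDerivWithinAt) (fun r _ => by simp)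
        (Metric.mem_ball_self hδ) hr
      rw [zero_mul, norm_le_zero_iff, sub_eq_zero] at this
      exact this.trans hks
    have hv : IsOpen {t | k t ≠ k 0} := isOpen_ne_fun hkc continuous_const
    have hJ : IsPreconnected J := isPreconnected_Ioo
    have h0J : (0 : ℝ) ∈ J := by constructor <;> linarith [ht.1, ht.2]
    have hsub := hJ.subset_left_of_subset_union hu hv
      (Set.disjoint_left.2 fun r hr hr' => hr' hr.2)
      (fun r hr => by by_cases h : k r = k 0 <;> [left; right] <;> simp_all)
      ⟨0, h0J, h0J, rfl⟩
    exact fun t ht => (hsub ht).2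
  have htJ : t ∈ J := ⟨by linarith [ht.1], by linarith [ht.2]⟩
  have hkt : |k t| < b := by rw [hconst t htJ]; exact hk0
  refine ⟨hmem t htJ hkt, ?_⟩
  rw [← h0, ← hconst t htJ]
  exact (div_mul_cancel₀ _ (bell_pos _).ne').symm

/-- Along an integral curve that starts in the region at distance more than `ε` from its sides,
the arc between two points is at most the variation of the first coordinate plus the variation
of the second. -/
lemma IsTangent.abs_sub_le (hV : IsTangent V σ a b) (hσ : σ ≠ 0) (hp : p ∈ gaussRegion σ a b)
    (hpε : |p.1| + ε < a) {s t : ℝ} (hs : s ∈ Icc (-ε) ε) (ht : t ∈ Icc (-ε) ε) :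
    |t - s| ≤ |(V.planeFlow p t).1 + |p.2 / bell σ p.1| * climb σ (V.planeFlow p t).1 -
      ((V.planeFlow p s).1 + |p.2 / bell σ p.1| * climb σ (V.planeFlow p s).1)| := by
  wlog hst : s < t generalizing s t
  · rcases eq_or_lt_of_le (not_lt.1 hst) with rfl | h
    · simp
    · rw [abs_sub_comm, abs_sub_comm (_ + _)]
      exact this ht hs h
  set c := V.planeFlow p with hc
  set K := p.2 / bell σ p.1 with hK
  -- Since `climb` is increasing, both terms vary in the same direction. Their sum has speed `|v.1|
  -- + |v.2|`, which is at least the Euclidean speed `1`.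
  have hder : ∀ t, HasDerivAt (fun t => (c t).1 + |K| * climb σ (c t).1)
      ((V (toTorus (c t))).1 + |K| * (|(c t).1| / σ ^ 2 * bell σ (c t).1 *
        (V (toTorus (c t))).1)) t := fun t =>
    (V.hasDerivAt_fst p t).add
      (HasDerivAt.const_mul |K| (HasDerivAt.comp (h₂ := climb σ) t (hasDerivAt_climb (c t).1)
        (V.hasDerivAt_fst p t)))
  obtain ⟨r, hr, hslope⟩ := exists_hasDerivAt_eq_slope
    (fun t => (c t).1 + |K| * climb σ (c t).1) _ hst
    (fun r _ => (hder r).continuousAt.continuousWithinAt) fun r _ => hder r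
  obtain ⟨hmem, hy⟩ := hV.planeFlow_eq hσ hp hpε
    (show r ∈ Icc (-ε) ε from ⟨by linarith [hs.1, hr.1], by linarith [ht.2, hr.2]⟩)
  have hsnd := hV.snd_eq hmem
  have hunit := V.unit (toTorus (c r))
  rw [← hc] at hmem hy hsnd
  set v := V (toTorus (c r))
  set m := |K| * (|(c r).1| / σ ^ 2 * bell σ (c r).1) with hm
  have hm0 : 0 ≤ m := by have := bell_pos (σ := σ) (c r).1; positivity
  have habs : |v.2| = m * |v.1| := by
    rw [hsnd, hy, abs_mul, abs_neg, abs_div, abs_mul, abs_mul, abs_of_pos (bell_pos _),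
      abs_of_pos (by positivity : 0 < σ ^ 2), hm]
    ring
  have hone : 1 ≤ |v.1 + |K| * (|(c r).1| / σ ^ 2 * bell σ (c r).1 * v.1)| := by
    have : v.1 + |K| * (|(c r).1| / σ ^ 2 * bell σ (c r).1 * v.1) = v.1 * (1 + m) := by
      rw [hm]; ring
    rw [this, abs_mul, abs_of_nonneg (by linarith : 0 ≤ 1 + m)]
    rw [← sq_abs v.1, ← sq_abs v.2, habs] at hunit
    have h1 : 1 ≤ (|v.1| * (1 + m)) ^ 2 := by
      nlinarith [mul_nonneg hm0 (sq_nonneg |v.1|)]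
    exact (one_le_sq_iff₀ (by positivity)).1 h1
  rw [hslope, abs_div, le_div_iff₀ (abs_pos.2 (by linarith)), one_mul] at hone
  exact hone

/-- The integral curves inside the region spend little time near the line `x = 0`. -/
lemma IsTangent.unif_le (hV : IsTangent V σ a b) (hσ : σ ≠ 0) (hp : p ∈ gaussRegion σ a b)
    (hε : 0 < ε) (hpε : |p.1| + ε < a) {L : ℝ} (hL : 0 ≤ L) :
    unif.real {u | |(V.planeFlow p (ε * u)).1| < L} ≤ (L + b) / ε := by
  have hKb : |p.2 / bell σ p.1| ≤ b := by
    rw [abs_div, abs_of_pos (bell_pos _), div_le_iff₀ (bell_pos _)]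
    exact hp.2.le
  have hb : 0 ≤ b := (abs_nonneg _).trans hKb
  have hmem : ∀ u ∈ Icc (-1 : ℝ) 1, ε * u ∈ Icc (-ε) ε := fun u hu =>
    ⟨by nlinarith [hu.1], by nlinarith [hu.2]⟩
  -- The set of times need not be an interval; a bound on its diameter is enough.
  have hvol : volume (Icc (-1) 1 ∩ {u | |(V.planeFlow p (ε * u)).1| < L}) ≤
      ENNReal.ofReal (2 * (L + b) / ε) := by
    refine (Real.volume_le_diam _).trans (Metric.ediam_le fun u hu u' hu' => ?_)
    rw [edist_dist, Real.dist_eq]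
    refine ENNReal.ofReal_le_ofReal ?_
    rw [le_div_iff₀ hε]
    have h := hV.abs_sub_le hσ hp hpε (hmem u' hu'.1) (hmem u hu.1)
    rw [← mul_sub, abs_mul, abs_of_pos hε, mul_comm] at h
    refine h.trans ?_
    have key : ∀ x, |x| < L → |x + |p.2 / bell σ p.1| * climb σ x| ≤ L + b := by
      intro x hx
      refine (abs_add_le _ _).trans (add_le_add hx.le ?_)
      rw [abs_mul, abs_abs]
      calc _ ≤ b * 1 := mul_le_mul hKb (abs_climb_le x) (abs_nonneg _) hb
        _ = b := mul_one b
    refine (abs_sub _ _).trans ?_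
    linarith [key _ hu.2, key _ hu'.2]
  have h2 : unif {u | |(V.planeFlow p (ε * u)).1| < L} ≤ ENNReal.ofReal ((L + b) / ε) := by
    rw [unif, cond_apply measurableSet_Icc, Real.volume_Icc]
    calc _ ≤ (ENNReal.ofReal (1 - -1))⁻¹ * ENNReal.ofReal (2 * (L + b) / ε) := by gcongr
      _ = ENNReal.ofReal ((L + b) / ε) := by
        rw [← ENNReal.ofReal_inv_of_pos (by norm_num), ← ENNReal.ofReal_mul (by norm_num)]
        congr 1
        ring
  exact ENNReal.toReal_le_of_le_ofReal (by positivity) h2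

/-- The endpoint `ε` decides the orientation, and the distances to `X 0` and `X ε` then determine
every other value. -/
lemma eq_add_or_eq_sub_of_isometry {X : ℝ → ℝ} (hε : 0 ≤ ε)
    (hX : ∀ s ∈ Icc (-ε) ε, ∀ t ∈ Icc (-ε) ε, |X t - X s| = |t - s|) :
    (∀ t ∈ Icc (-ε) ε, X t = X 0 + t) ∨ ∀ t ∈ Icc (-ε) ε, X t = X 0 - t := by
  have h0 : (0 : ℝ) ∈ Icc (-ε) ε := ⟨by linarith, hε⟩
  have h1 : ε ∈ Icc (-ε) ε := ⟨by linarith, le_rfl⟩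
  rcases abs_eq_abs.1 (hX 0 h0 ε h1) with h | h
  · left
    intro t ht
    have h2 := hX t ht ε h1
    rw [abs_of_nonneg (by linarith [ht.2] : 0 ≤ ε - t)] at h2
    rcases abs_eq_abs.1 (hX 0 h0 t ht) with h3 | h3
    · linarith
    · rcases abs_cases (X ε - X t) with h4 | h4 <;> linarith [ht.1, ht.2]
  · right
    intro t ht
    have h2 := hX t ht ε h1
    rw [abs_of_nonneg (by linarith [ht.2] : 0 ≤ ε - t)] at h2
    rcases abs_eq_abs.1 (hX 0 h0 t ht) with h3 | h3
    · rcases abs_cases (X ε - X t) with h4 | h4 <;> linarith [ht.1, ht.2]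
    · linarith

/-- Integral curves through the points of the stable segment follow the stable direction. -/
lemma IsTangent.planeFlow_zero_snd (hV : IsTangent V σ a b) (hσ : σ ≠ 0) (hb : 0 < b) {x : ℝ}
    (hε : 0 ≤ ε) (hx : |x| + ε < a) :
    (∀ t ∈ Icc (-ε) ε, V.planeFlow (x, 0) t = (x + t, 0)) ∨
      ∀ t ∈ Icc (-ε) ε, V.planeFlow (x, 0) t = (x - t, 0) := by
  have hp : (x, (0 : ℝ)) ∈ gaussRegion σ a b := by
    refine ⟨show |x| < a by linarith, ?_⟩
    rw [abs_zero]
    exact mul_pos hb (bell_pos _)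
  have hsnd : ∀ t ∈ Icc (-ε) ε, (V.planeFlow (x, 0) t).2 = 0 := fun t ht => by
    simpa using (hV.planeFlow_eq hσ hp hx ht).2
  set X : ℝ → ℝ := fun t => (V.planeFlow (x, 0) t).1 with hX
  have hiso : ∀ s ∈ Icc (-ε) ε, ∀ t ∈ Icc (-ε) ε, |X t - X s| = |t - s| := fun s hs t ht =>
    (V.abs_fst_sub_le _ _ _).antisymm (by simpa using hV.abs_sub_le hσ hp hx hs ht)
  have h0 : X 0 = x := by simp [hX, V.planeFlow_zero]
  refine (eq_add_or_eq_sub_of_isometry hε hiso).imp ?_ ?_ <;> rw [h0] <;>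
    exact fun h t ht => Prod.ext (h t ht) (hsnd t ht)

end curve

end

section

/-! ### The potential -/

variable {σ ε a b : ℝ} {V : UnitVectorField}

/-- The square root of the level, relative to `b`, of the Gaussian curve through the image of a
point under the Cat Map, cut off at `1`. -/
def potential (σ a b : ℝ) : Torus → ℝ :=
  Function.extend (fun p : gaussRegion σ a b => toTorus p)
    (fun p => min 1 √(lam * |p.1.2| / (b * bell σ (mu * p.1.1)))) fun _ => 1

section potential

variable (inj : InjOn toTorus (gaussRegion σ a b))
include inj

lemma potential_toTorus {p : ℝ × ℝ} (hp : p ∈ gaussRegion σ a b) :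
    potential σ a b (toTorus p) = min 1 √(lam * |p.2| / (b * bell σ (mu * p.1))) :=
  (injOn_iff_injective.1 inj).extend_apply
    (fun p : gaussRegion σ a b => min 1 √(lam * |p.1.2| / (b * bell σ (mu * p.1.1)))) _ ⟨p, hp⟩

lemma measurable_potential : Measurable (potential σ a b) := by
  have he : MeasurableEmbedding fun p : gaussRegion σ a b => toTorus p := by
    have : StandardBorelSpace (gaussRegion σ a b) :=
      (isOpen_gaussRegion (σ := σ) (a := a) (b := b)).measurableSet.standardBorel
    exact (continuous_toTorus.measurable.comp measurable_subtype_coe).measurableEmbedding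
      (injOn_iff_injective.1 inj)
  refine he.measurable_extend ?_ measurable_const
  have h := (continuous_bell (σ := σ)).measurable
  have h1 : Measurable fun p : gaussRegion σ a b => p.1.1 := by fun_prop
  have h2 : Measurable fun p : gaussRegion σ a b => p.1.2 := by fun_prop
  have h3 : Measurable fun p : gaussRegion σ a b => |p.1.2| :=
    continuous_abs.measurable.comp h2
  exact measurable_const.min
    (((h3.const_mul _).div ((h.comp (h1.const_mul _)).const_mul _)).sqrt)

lemma potential_mem (q : Torus) : potential σ a b q ∈ Icc (0 : ℝ) 1 := by
  by_cases h : ∃ p : gaussRegion σ a b, toTorus p = q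
  · obtain ⟨p, rfl⟩ := h
    rw [potential_toTorus inj p.2]
    exact ⟨le_min zero_le_one (Real.sqrt_nonneg _), min_le_left _ _⟩
  · rw [potential, Function.extend_apply' _ _ _ h]
    exact ⟨zero_le_one, le_rfl⟩

lemma abs_potential_le (q : Torus) : |potential σ a b q| ≤ 1 :=
  abs_le.2 ⟨by linarith [(potential_mem inj q).1], (potential_mem inj q).2⟩

lemma exists_of_potential_lt {q : Torus} {δ : ℝ} (hδ : δ ≤ 1) (hb : 0 < b)
    (h : potential σ a b q < δ) :
    ∃ p ∈ gaussRegion σ a b, toTorus p = q ∧ lam * |p.2| < δ ^ 2 * (b * bell σ (mu * p.1)) ∧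
      potential σ a b q = √(lam * |p.2| / (b * bell σ (mu * p.1))) := by
  by_cases hq : ∃ p : gaussRegion σ a b, toTorus p = q
  · obtain ⟨p, rfl⟩ := hq
    rw [potential_toTorus inj p.2] at h ⊢
    have h1 : √(lam * |p.1.2| / (b * bell σ (mu * p.1.1))) < δ :=
      (min_lt_iff.1 h).resolve_left (not_lt.2 hδ)
    refine ⟨p, p.2, rfl, ?_, min_eq_right (h1.le.trans hδ)⟩
    have hδ0 : 0 < δ := (Real.sqrt_nonneg _).trans_lt h1
    rw [Real.sqrt_lt' hδ0, div_lt_iff₀ (mul_pos hb (bell_pos _))] at h1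
    exact h1
  · rw [potential, Function.extend_apply' _ _ _ hq] at h
    exact absurd h (not_lt.2 hδ)

lemma potential_lt {p : ℝ × ℝ} {δ : ℝ} (hδ : 0 < δ) (hb : 0 < b) (hp : p ∈ gaussRegion σ a b)
    (h : lam * |p.2| < δ ^ 2 * (b * bell σ (mu * p.1))) : potential σ a b (toTorus p) < δ := by
  rw [potential_toTorus inj hp]
  refine (min_le_right _ _).trans_lt ?_
  rwa [Real.sqrt_lt' hδ, div_lt_iff₀ (mul_pos hb (bell_pos _))]

end potential

/-- The exponential on the right is, up to `lam`, the factor by which the Cat Map changes the level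
of a point with first coordinate `x`. -/
lemma lam_mul_bell (x : ℝ) :
    lam * bell σ x = lam * Real.exp (-((1 - mu ^ 2) * x ^ 2 / (2 * σ ^ 2))) * bell σ (mu * x) := by
  rw [bell, bell, mul_assoc, ← Real.exp_add]
  congr 2
  ring

lemma mu_sq_lt_one : mu ^ 2 < 1 := pow_lt_one₀ mu_pos.le mu_lt_one two_ne_zero

/-- One step of the dynamics on a Gaussian curve multiplies the square root of the level by at
most `√lam` in general, and by at most `1 / √lam` away from the line `x = 0`. -/
lemma sqrt_lam_mul_exp_le (hσ : 0 < σ) (x : ℝ) :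
    √(lam * Real.exp (-((1 - mu ^ 2) * x ^ 2 / (2 * σ ^ 2)))) ≤
      tau + indicator {x | |x| < σ * √(4 * Real.log lam / (1 - mu ^ 2))} 1 x := by
  have hlam : 0 < lam := zero_lt_one.trans one_lt_lam
  have hmu : 0 < 1 - mu ^ 2 := by linarith [mu_sq_lt_one]
  by_cases hx : |x| < σ * √(4 * Real.log lam / (1 - mu ^ 2))
  · rw [indicator_of_mem (mem_ofPred (p := fun x => |x| < _) |>.2 hx), Pi.one_apply,
      add_comm, ← sqrt_lam]
    refine Real.sqrt_le_sqrt (mul_le_of_le_one_right hlam.le (Real.exp_le_one_iff.2 ?_))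
    have : 0 ≤ (1 - mu ^ 2) * x ^ 2 / (2 * σ ^ 2) := by positivity
    linarith
  · rw [indicator_of_notMem (mt (mem_ofPred (p := fun x => |x| < _)).1 hx), add_zero,
      Real.sqrt_le_left (by linarith [tau_bounds.1])]
    have hlog : 0 < Real.log lam := Real.log_pos one_lt_lam
    -- The `4` under the root in (B1) is what makes the exponential at most `lam⁻²`, so that it
    -- turns the expansion `lam` into `lam⁻¹`.
    have h1 : 2 * Real.log lam ≤ (1 - mu ^ 2) * x ^ 2 / (2 * σ ^ 2) := by
      have h2 := pow_le_pow_left₀ (by positivity) (not_lt.1 hx) 2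
      rw [mul_pow, Real.sq_sqrt (by positivity), sq_abs] at h2
      rw [le_div_iff₀ (by positivity)]
      calc 2 * Real.log lam * (2 * σ ^ 2)
          = (1 - mu ^ 2) * (σ ^ 2 * (4 * Real.log lam / (1 - mu ^ 2))) := by
            field_simp; ring
        _ ≤ _ := mul_le_mul_of_nonneg_left h2 hmu.le
    calc lam * Real.exp (-((1 - mu ^ 2) * x ^ 2 / (2 * σ ^ 2)))
        ≤ lam * Real.exp (-(2 * Real.log lam)) := by gcongr
      _ = lam⁻¹ := by
        rw [two_mul, neg_add, Real.exp_add, Real.exp_neg, Real.exp_log hlam]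
        field_simp
      _ = tau ^ 2 := by
        rw [inv_eq_of_mul_eq_one_left mu_mul_lam, tau_sq, mu_eq]

/-- The potential decreases in the mean where it is less than `1`. -/
lemma step_potential_le (inj : InjOn toTorus (gaussRegion σ a b)) (hV : IsTangent V σ a b)
    (hε : 0 < ε) (hb : 0 < b) (hσ : 0 < σ) (ha : a = ε / (1 - mu))
    (hB1 : 3 * (σ * √(4 * Real.log lam / (1 - mu ^ 2)) + b) < ε) {q : Torus}
    (hq : potential σ a b q < 1) :
    step V ε (potential σ a b) q ≤ (tau + 1 / 3) * potential σ a b q := by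
  obtain ⟨p, hp, rfl, hlt, hpot⟩ := exists_of_potential_lt inj le_rfl hb hq
  have hmu := mu_pos
  have hmu1 : 0 < 1 - mu := by linarith [mu_lt_one]
  have hlam : 0 < lam := zero_lt_one.trans one_lt_lam
  -- The number `a` is the fixed point of `x ↦ mu * x + ε`, so the image of a point of the region
  -- keeps a distance greater than `ε` from the sides and its whole arc stays in the region.
  have haε : mu * a + ε = a := by rw [ha]; field_simp; ring
  set p' : ℝ × ℝ := (mu * p.1, lam * p.2) with hp'
  have hx' : |p'.1| + ε < a := by
    rw [← haε, hp', abs_mul, abs_of_pos hmu]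
    linarith [mul_lt_mul_of_pos_left hp.1 hmu]
  have hp'm : p' ∈ gaussRegion σ a b := by
    refine ⟨by linarith, ?_⟩
    rw [hp', abs_mul, abs_of_pos hlam, gauss_eq]
    rwa [one_pow, one_mul] at hlt
  set K := p'.2 / bell σ p'.1 with hK
  have hv : potential σ a b (toTorus p) = √(|K| / b) := by
    rw [hpot, hK, abs_div, abs_of_pos (bell_pos _), hp', abs_mul, abs_of_pos hlam]
    congr 1
    field_simp
  set L := σ * √(4 * Real.log lam / (1 - mu ^ 2)) with hL
  have hL0 : 0 ≤ L := by positivity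
  have hbound : ∀ u ∈ Icc (-1 : ℝ) 1,
      potential σ a b (V.flow (catMap (toTorus p)) (ε * u)) ≤
        √(|K| / b) * (tau + indicator {u | |(V.planeFlow p' (ε * u)).1| < L} 1 u) := by
    intro u hu
    have hu' : ε * u ∈ Icc (-ε) ε := ⟨by nlinarith [hu.1], by nlinarith [hu.2]⟩
    obtain ⟨hmem, hy⟩ := hV.planeFlow_eq hσ.ne' hp'm hx' hu'
    rw [catMap_toTorus, V.flow_toTorus, potential_toTorus inj hmem]
    refine (min_le_right _ _).trans ?_
    set x := (V.planeFlow p' (ε * u)).1 with hx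
    have h1 : lam * |(V.planeFlow p' (ε * u)).2| / (b * bell σ (mu * x)) =
        |K| / b * (lam * Real.exp (-((1 - mu ^ 2) * x ^ 2 / (2 * σ ^ 2)))) := by
      have := (bell_pos (σ := σ) (mu * x)).ne'
      rw [hy, ← hK, abs_mul, abs_of_pos (bell_pos _), mul_left_comm, lam_mul_bell]
      field_simp
    rw [h1, Real.sqrt_mul (by positivity)]
    exact mul_le_mul_of_nonneg_left (sqrt_lam_mul_exp_le hσ x) (Real.sqrt_nonneg _)
  have hms : MeasurableSet {u | |(V.planeFlow p' (ε * u)).1| < L} := by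
    have := V.continuous_planeFlow_right p'
    exact (isOpen_lt (by fun_prop) continuous_const).measurableSet
  have hint : Integrable (indicator {u | |(V.planeFlow p' (ε * u)).1| < L} (1 : ℝ → ℝ)) unif :=
    (integrable_const (1 : ℝ)).indicator hms
  calc step V ε (potential σ a b) (toTorus p)
      ≤ ∫ u, √(|K| / b) * (tau + indicator {u | |(V.planeFlow p' (ε * u)).1| < L} 1 u) ∂unif := by
        refine integral_mono_ae (integrable_step V ε (measurable_potential inj)
          (abs_potential_le inj) _) (((integrable_const _).add hint).const_mul _) ?_
        filter_upwards [ae_unif_mem] with u hu using hbound u hu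
    _ = √(|K| / b) * (tau + unif.real {u | |(V.planeFlow p' (ε * u)).1| < L}) := by
        rw [integral_const_mul, integral_add (integrable_const _) hint, integral_indicator_one hms]
        simp
    _ ≤ √(|K| / b) * (tau + 1 / 3) := by
        gcongr
        refine (hV.unif_le hσ.ne' hp'm hε hx' hL0).trans ?_
        rw [div_le_div_iff₀ hε three_pos]
        linarith
    _ = _ := by rw [hv]; ring

end

section

/-! ### Reaching the stable segment -/

lemma iterate_catMap_toTorus (n : ℕ) (p : ℝ × ℝ) :
    catMap^[n] (toTorus p) = toTorus (mu ^ n * p.1, lam ^ n * p.2) := by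
  induction n with
  | zero => simp
  | succ n ih =>
    rw [Function.iterate_succ_apply', ih, catMap_toTorus]
    congr 2 <;> ring

lemma lam_pos : 0 < lam := zero_lt_one.trans one_lt_lam

lemma toTorus_sub {p h : ℝ × ℝ} (hh : toTorus h = 0) : toTorus (p - h) = toTorus p := by
  have := toTorus_add (p - h) h
  rw [sub_add_cancel, hh, add_zero] at this
  exact this.symm

/-- The `n`-th power of the matrix maps the lattice into itself. Pull `p` back by it, subtract the
representative of the result in the unit square, and push forward: the remainder, of size at most
`2`, is contracted by `mu ^ n` and stretched by `lam ^ n`. -/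
lemma exists_lattice_near (n : ℕ) (p : ℝ × ℝ) :
    ∃ l, toTorus l = 0 ∧ |p.1 - l.1| ≤ 2 * mu ^ n ∧ |p.2 - l.2| ≤ 2 * lam ^ n := by
  have hmu := mu_pos
  have hlam := lam_pos
  have hml : mu ^ n * lam ^ n = 1 := by rw [← mul_pow, mu_mul_lam, one_pow]
  set p₀ : ℝ × ℝ := (lam ^ n * p.1, mu ^ n * p.2) with hp₀
  set d := lift (toTorus p₀) with hd
  have h0 : catMap^[n] 0 = 0 := by
    have h : catMap 0 = 0 := by simp [catMap]
    exact Function.iterate_fixed h n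
  have hdn : |d.1| ≤ 2 ∧ |d.2| ≤ 2 := by
    have := norm_lift_le (toTorus p₀)
    rwa [Prod.norm_def, max_le_iff] at this
  refine ⟨(mu ^ n * (p₀ - d).1, lam ^ n * (p₀ - d).2), ?_, ?_, ?_⟩
  · rw [← iterate_catMap_toTorus, UnitVectorField.toTorus_sub_lift, h0]
  · have : p.1 - mu ^ n * (p₀ - d).1 = mu ^ n * d.1 := by
      simp only [Prod.fst_sub, hp₀]
      linear_combination (-p.1) * hml
    rw [this, abs_mul, abs_of_pos (by positivity), mul_comm]
    exact mul_le_mul_of_nonneg_right hdn.1 (by positivity)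
  · have : p.2 - lam ^ n * (p₀ - d).2 = lam ^ n * d.2 := by
      simp only [Prod.snd_sub, hp₀]
      linear_combination (-p.2) * hml
    rw [this, abs_mul, abs_of_pos (by positivity), mul_comm]
    exact mul_le_mul_of_nonneg_right hdn.2 (by positivity)

variable {σ ε a b β φ : ℝ} {V : UnitVectorField}

/-- An arc which is not contained in a stable line has an image that meets the stable segment. -/
lemma exists_iterate_mem_segment_of_lt (V : UnitVectorField) (p : ℝ × ℝ) (ha : 0 < a) {s t : ℝ}
    (hst : (V.planeFlow p s).2 < (V.planeFlow p t).2) :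
    ∃ r ∈ uIcc s t, ∃ n x, |x| < a ∧ catMap^[n] (toTorus (V.planeFlow p r)) = toTorus (x, 0) := by
  have hmu := mu_pos
  have hlam := lam_pos
  have htm := tendsto_pow_atTop_nhds_zero_of_lt_one mu_pos.le mu_lt_one
  have htl := tendsto_pow_atTop_atTop_of_one_lt one_lt_lam
  obtain ⟨m, hm⟩ := (htm.eventually_lt_const (show 0 < a / 4 by positivity)).exists
  set c := V.planeFlow p with hc
  set δ := (c t).2 - (c s).2 with hδ
  have hδ0 : 0 < δ := sub_pos.2 hst
  have h1 : ∀ᶠ n : ℕ in atTop, mu ^ n * |t - s| < a / 2 := by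
    have := htm.mul_const |t - s|
    rw [zero_mul] at this
    exact this.eventually_lt_const (by positivity)
  -- The image of the arc then has height greater than `4 * lam ^ m`, so it meets the horizontal
  -- line through a lattice point at most `2 * lam ^ m` away from its mid-height. The choice of `m`
  -- and `h1` keep the crossing within `a` of that lattice point.
  have h2 : ∀ᶠ n : ℕ in atTop, 4 * lam ^ m / δ < lam ^ n := htl.eventually_gt_atTop _
  obtain ⟨n, hn1, hn2⟩ := (h1.and h2).exists
  rw [div_lt_iff₀ hδ0] at hn2
  obtain ⟨l, hl, hl1, hl2⟩ := exists_lattice_near m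
    (mu ^ n * (c s).1, lam ^ n * ((c s).2 + δ / 2))
  simp only [abs_le] at hl2
  have hln : 0 < lam ^ n := by positivity
  obtain ⟨r, hr, hrl⟩ : ∃ r ∈ uIcc s t, (c r).2 = l.2 / lam ^ n := by
    have hcont : Continuous fun t => (c t).2 := (V.continuous_planeFlow_right p).snd
    refine intermediate_value_uIcc hcont.continuousOn ?_
    rw [uIcc_of_le hst.le, mem_Icc, le_div_iff₀ hln, div_le_iff₀ hln]
    constructor
    · nlinarith [hl2.2]
    · nlinarith [hl2.1]
  refine ⟨r, hr, n, mu ^ n * (c r).1 - l.1, ?_, ?_⟩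
  · have h3 : |(c r).1 - (c s).1| ≤ |t - s| :=
      (V.abs_fst_sub_le p s r).trans (abs_sub_left_of_mem_uIcc hr)
    calc |mu ^ n * (c r).1 - l.1|
        = |mu ^ n * ((c r).1 - (c s).1) + (mu ^ n * (c s).1 - l.1)| := by ring_nf
      _ ≤ mu ^ n * |(c r).1 - (c s).1| + |mu ^ n * (c s).1 - l.1| := by
        refine (abs_add_le _ _).trans_eq ?_
        rw [abs_mul, abs_of_pos (by positivity : 0 < mu ^ n)]
      _ ≤ mu ^ n * |t - s| + 2 * mu ^ m := by gcongr
      _ < a := by linarith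
  · rw [iterate_catMap_toTorus, ← toTorus_sub hl]
    congr 1
    ext
    · rfl
    · simp only [Prod.snd_sub, hrl]
      field_simp
      ring

/-! ### Arcs parallel to the stable direction -/

lemma one_sub_mu : 1 - mu = tau := by rw [mu_eq]; ring

/-- (B1) makes the Gaussian narrow compared with an arc: at `ε / 2` the profile has lost a factor
`lam`. Since `b + β ≤ lam * b`, the outer boundary curve is there at height at most `b`. -/
lemma bell_half_le (hσ : 0 < σ) (hb : 0 < b)
    (hB1 : 3 * (σ * √(4 * Real.log lam / (1 - mu ^ 2)) + b) < ε) : lam * bell σ (ε / 2) ≤ 1 := by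
  have hlog : 0 < Real.log lam := Real.log_pos one_lt_lam
  have hmu : 0 < 1 - mu ^ 2 := by linarith [mu_sq_lt_one]
  have h1 : 36 * σ ^ 2 * Real.log lam ≤ ε ^ 2 := by
    have h2 : 3 * (σ * √(4 * Real.log lam / (1 - mu ^ 2))) ≤ ε := by linarith
    have h3 := pow_le_pow_left₀ (by positivity) h2 2
    rw [mul_pow, mul_pow, Real.sq_sqrt (by positivity)] at h3
    have h4 : 4 * Real.log lam ≤ 4 * Real.log lam / (1 - mu ^ 2) := by
      rw [le_div_iff₀ hmu]
      nlinarith [sq_nonneg mu]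
    nlinarith [mul_le_mul_of_nonneg_left h4 (sq_nonneg σ)]
  have h5 : Real.log lam ≤ (ε / 2) ^ 2 / (2 * σ ^ 2) := by
    rw [le_div_iff₀ (by positivity)]
    nlinarith [mul_pos (sq_pos_of_pos hσ) hlog]
  rw [bell, neg_div]
  calc lam * Real.exp (-((ε / 2) ^ 2 / (2 * σ ^ 2)))
      ≤ lam * Real.exp (-Real.log lam) :=
        mul_le_mul_of_nonneg_left (Real.exp_le_exp.2 (neg_le_neg h5)) lam_pos.le
    _ = 1 := by rw [Real.exp_neg, Real.exp_log lam_pos, mul_inv_cancel₀ lam_pos.ne']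

/-- An arc contained in a stable line meets the stable segment. -/
lemma exists_mem_segment_of_horizontal (hε : 0 < ε) (hb : 0 < b) (hβ : 0 < β) (hσ : 0 < σ)
    (hφ : φ ∈ Ioo (-(Real.pi / 2)) (Real.pi / 2)) (ha : a = ε / (1 - mu))
    (hU : InjOn toTorus (gaussRegion σ (a + β / 2) (b + β))) (hV : IsTangent V σ a b)
    (hVU : ∀ q ∉ toTorus '' gaussRegion σ (a + β / 2) (b + β),
      V q = (Real.sin φ, Real.cos φ) ∨ V q = -(Real.sin φ, Real.cos φ))
    (hB1 : 3 * (σ * √(4 * Real.log lam / (1 - mu ^ 2)) + b) < ε)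
    (hB2 : β < ε / 7 ∧ β ≤ (lam - 1) * b) {p : ℝ × ℝ}
    (hp : ∀ t ∈ Icc (-ε) ε, (V.planeFlow p t).2 = p.2) :
    ∃ t ∈ Icc (-ε) ε, ∃ x, |x| < a ∧ toTorus (V.planeFlow p t) = toTorus (x, 0) := by
  set c := V.planeFlow p with hc
  have hcc : Continuous c := V.continuous_planeFlow_right p
  set U := gaussRegion σ (a + β / 2) (b + β)
  have hV2 : ∀ t ∈ Ioo (-ε) ε, (V (toTorus (c t))).2 = 0 := by
    intro t ht
    refine (V.hasDerivAt_snd p t).unique ((hasDerivAt_const t p.2).congr_of_eventuallyEq ?_)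
    filter_upwards [Ioo_mem_nhds ht.1 ht.2] with s hs using hp s (Ioo_subset_Icc_self hs)
  have hV1 : ∀ t ∈ Ioo (-ε) ε, |(V (toTorus (c t))).1| = 1 := by
    intro t ht
    have := V.unit (toTorus (c t))
    rw [hV2 t ht] at this
    rw [← sq_eq_sq₀ (abs_nonneg _) zero_le_one, sq_abs]
    linarith
  -- Outside `U'` the unstable component of the field is `± cos φ ≠ 0`.
  have hmemU : ∀ t ∈ Ioo (-ε) ε, ∃ p₀ ∈ U, toTorus p₀ = toTorus (c t) := by
    intro t ht
    by_contra hn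
    have hcos := Real.cos_pos_of_mem_Ioo hφ
    rcases hVU (toTorus (c t)) hn with h | h
    · have := hV2 t ht
      rw [h] at this
      exact hcos.ne' this
    · have := hV2 t ht
      rw [h] at this
      exact hcos.ne' (neg_eq_zero.1 this)
  have hiso : ∀ s ∈ Icc (-ε) ε, ∀ t ∈ Icc (-ε) ε, |(c t).1 - (c s).1| = |t - s| := by
    intro s hs t ht
    wlog hst : s < t generalizing s t
    · rcases eq_or_lt_of_le (not_lt.1 hst) with rfl | h
      · simp
      · rw [abs_sub_comm, abs_sub_comm t s]
        exact this t ht s hs h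
    obtain ⟨r, hr, hslope⟩ := exists_hasDerivAt_eq_slope _ _ hst
      (hcc.fst.continuousOn) fun r _ => V.hasDerivAt_fst p r
    have h1 := hV1 r ⟨hs.1.trans_lt hr.1, hr.2.trans_le ht.2⟩
    rw [hc, hslope, abs_div, div_eq_one_iff_eq (abs_pos.2 (by linarith)).ne'] at h1
    exact h1
  have h0 : (0 : ℝ) ∈ Ioo (-ε) ε := ⟨by linarith, hε⟩
  have hc0 : c 0 = p := V.planeFlow_zero p
  -- the arc stays in one translate of the region
  obtain ⟨p₀, hp₀, hp₀c⟩ := hmemU 0 h0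
  set l := c 0 - p₀ with hl
  have hl0 : toTorus l = 0 := by
    have := toTorus_add l p₀
    rw [hl, sub_add_cancel, ← hp₀c] at this
    exact right_eq_add.1 this
  -- Injectivity on `U` makes its lattice translates disjoint, so the connected lift of the arc
  -- stays in one of them.
  have hsub : Ioo (-ε) ε ⊆ (fun t => c t - l) ⁻¹' U := by
    have hUo : IsOpen U := isOpen_gaussRegion
    have hu : IsOpen ((fun t => c t - l) ⁻¹' U) := hUo.preimage (hcc.sub continuous_const)
    have hv : IsOpen (⋃ l' ∈ {l' | toTorus l' = 0 ∧ l' ≠ l}, (fun t => c t - l') ⁻¹' U) :=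
      isOpen_biUnion fun l' _ => hUo.preimage (hcc.sub continuous_const)
    refine isPreconnected_Ioo.subset_left_of_subset_union hu hv ?_ ?_ ⟨0, h0, ?_⟩
    · rw [Set.disjoint_left]
      intro t ht ht'
      simp only [mem_iUnion] at ht'
      obtain ⟨l', ⟨hl', hne⟩, ht'⟩ := ht'
      have := hU ht ht' (by rw [toTorus_sub hl0, toTorus_sub hl'])
      exact hne (sub_right_injective this).symm
    · intro t ht
      obtain ⟨p₁, hp₁, h₁⟩ := hmemU t ht
      by_cases hll : c t - p₁ = l
      · left
        show c t - l ∈ U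
        rwa [← hll, sub_sub_cancel]
      · right
        simp only [mem_iUnion]
        refine ⟨c t - p₁, ⟨?_, hll⟩, ?_⟩
        · have := toTorus_add (c t - p₁) p₁
          rw [sub_add_cancel, ← h₁] at this
          exact right_eq_add.1 this
        · show c t - (c t - p₁) ∈ U
          rwa [sub_sub_cancel]
    · show c 0 - l ∈ U
      rwa [hl, sub_sub_cancel]
  have hstay : ∀ t ∈ Ioo (-ε) ε, c t - l ∈ U := fun t ht => hsub ht
  set x₀ := p.1 - l.1 with hx₀
  set y := p.2 - l.2 with hy
  have hline : ∀ z, |z - x₀| < ε → ∃ t ∈ Ioo (-ε) ε, c t - l = (z, y) := by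
    intro z hz
    have hz' := abs_lt.1 hz
    rcases eq_add_or_eq_sub_of_isometry (X := fun t => (c t).1) hε.le hiso with h | h <;>
      simp only [hc0] at h
    · have ht : z - x₀ ∈ Ioo (-ε) ε := hz'
      refine ⟨z - x₀, ht, Prod.ext ?_ ?_⟩
      · rw [Prod.fst_sub, h _ (Ioo_subset_Icc_self ht), hx₀]
        ring
      · rw [Prod.snd_sub, hp _ (Ioo_subset_Icc_self ht)]
    · have ht : x₀ - z ∈ Ioo (-ε) ε := ⟨by linarith, by linarith⟩
      refine ⟨x₀ - z, ht, Prod.ext ?_ ?_⟩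
      · rw [Prod.fst_sub, h _ (Ioo_subset_Icc_self ht), hx₀]
        ring
      · rw [Prod.snd_sub, hp _ (Ioo_subset_Icc_self ht)]
  have hlineU : ∀ z, |z - x₀| < ε → (z, y) ∈ U ∧ (V (toTorus (z, y))).2 = 0 := by
    intro z hz
    obtain ⟨t, ht, hct⟩ := hline z hz
    rw [← hct]
    exact ⟨hstay t ht, by rw [toTorus_sub hl0]; exact hV2 t ht⟩
  have ha1 : a < 1.62 * ε := by
    rw [ha, one_sub_mu, div_lt_iff₀ (by linarith [tau_bounds.1])]
    nlinarith [tau_bounds.1]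
  have ha0 : 0 < a := by rw [ha, one_sub_mu]; exact div_pos hε (by linarith [tau_bounds.1])
  -- The points `x₀ ± 9/10 ε` of the arc lie within `a + β / 2 < 1.62 ε + ε / 14 < 1.7 ε` of zero.
  -- Hence the arc passes over `0` and over one of `± ε / 2`.
  have hx₀ε : |x₀| < 4 / 5 * ε := by
    have h1 := (hlineU (x₀ + 9 / 10 * ε) (by
      rw [add_sub_cancel_left, abs_of_pos (by positivity)]; linarith)).1.1
    have h2 := (hlineU (x₀ - 9 / 10 * ε) (by
      rw [sub_sub_cancel_left, abs_neg, abs_of_pos (by positivity)]; linarith)).1.1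
    rw [abs_lt] at h1 h2 ⊢
    constructor <;> linarith [h1.2, h2.1]
  have hy_lt : |y| < b := by
    obtain ⟨z, hz, hbz⟩ : ∃ z, |z - x₀| < ε ∧ bell σ z = bell σ (ε / 2) := by
      rw [abs_lt] at hx₀ε
      rcases le_total 0 x₀ with h | h
      · exact ⟨ε / 2, abs_lt.2 ⟨by linarith, by linarith⟩, rfl⟩
      · exact ⟨-(ε / 2), abs_lt.2 ⟨by linarith, by linarith⟩, by simp [bell]⟩
    have h1 : |y| < (b + β) * bell σ z := (hlineU z hz).1.2
    have h2 := bell_half_le hσ hb hB1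
    have h3 := bell_pos (σ := σ) (ε / 2)
    rw [hbz] at h1
    calc |y| < (b + β) * bell σ (ε / 2) := h1
      _ ≤ (lam * b) * bell σ (ε / 2) := by gcongr; linarith [hB2.2]
      _ = b * (lam * bell σ (ε / 2)) := by ring
      _ ≤ b := mul_le_of_le_one_right hb.le h2
  -- Otherwise the arc would run horizontally through points of `W` close to the axis `x = 0` but
  -- off it, where the Gaussian curves of nonzero level have nonzero slope.
  have hy0 : y = 0 := by
    by_contra hy0
    have hO : IsOpen {z : ℝ | (z, y) ∈ gaussRegion σ a b ∧ |z - x₀| < ε} :=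
      (isOpen_gaussRegion.preimage (by fun_prop : Continuous fun z : ℝ => (z, y))).inter
        (isOpen_lt (by fun_prop : Continuous fun z : ℝ => |z - x₀|) continuous_const)
    have h0O : (0 : ℝ) ∈ {z : ℝ | (z, y) ∈ gaussRegion σ a b ∧ |z - x₀| < ε} := by
      refine ⟨⟨?_, ?_⟩, ?_⟩
      · simpa using ha0
      · rw [gauss_eq, bell_zero, mul_one]; exact hy_lt
      · rw [zero_sub, abs_neg]; linarith
    have hev : ∀ᶠ z in 𝓝[≠] (0 : ℝ), z ≠ 0 ∧ (z, y) ∈ gaussRegion σ a b ∧ |z - x₀| < ε :=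
      (eventually_mem_nhdsWithin).and (mem_nhdsWithin_of_mem_nhds (hO.mem_nhds h0O))
    obtain ⟨z, hz0, hzm, hzx⟩ := hev.exists
    have h1 := hV.snd_eq hzm
    have h2 := (hlineU z hzx).2
    have h3 := V.unit (toTorus (z, y))
    rw [h2] at h1 h3
    have h4 : (V (toTorus (z, y))).1 ≠ 0 := by
      intro h
      rw [h] at h3
      norm_num at h3
    have h5 : z * y / σ ^ 2 ≠ 0 := div_ne_zero (mul_ne_zero hz0 hy0) (by positivity)
    exact mul_ne_zero (neg_ne_zero.2 h5) h4 h1.symm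
  obtain ⟨t, ht, hct⟩ := hline 0 (by rw [zero_sub, abs_neg]; linarith)
  refine ⟨t, Ioo_subset_Icc_self ht, 0, by simpa using ha0, ?_⟩
  rw [← toTorus_sub hl0, hct, hy0]

end

section

/-! ### Decay of the mean potential -/

variable {σ ε a b β φ : ℝ} {V : UnitVectorField}

lemma flow_zero (q : Torus) : V.flow q 0 = q := by
  rw [UnitVectorField.flow, V.planeFlow_zero, toTorus_lift]

/-- Zero noise is admissible, and by continuity small noise does almost the same, so the chain
follows deterministic orbits with positive probability. -/
lemma iterate_step_pos {h : Torus → ℝ} (hc : Continuous h) (h0 : ∀ q, 0 ≤ h q) (n : ℕ)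
    {q : Torus} (hq : 0 < h (catMap^[n] q)) : 0 < (step V ε)^[n] h q := by
  have hn : ∀ n q, 0 ≤ (step V ε)^[n] h q := by
    intro n
    induction n with
    | zero => exact h0
    | succ n ih => rw [Function.iterate_succ_apply']; exact step_nonneg V ε ih
  induction n generalizing q with
  | zero => exact hq
  | succ n ih =>
    rw [Function.iterate_succ_apply']
    refine step_pos V ε (continuous_iterate_step V ε hc n) (hn n) (u := 0) (by simp) ?_
    rw [mul_zero, flow_zero]
    exact ih hq

/-- The stable segment can be reached from every point. -/
lemma exists_reach_segment (hε : 0 < ε) (hb : 0 < b) (hβ : 0 < β) (hσ : 0 < σ)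
    (hφ : φ ∈ Ioo (-(Real.pi / 2)) (Real.pi / 2)) (ha : a = ε / (1 - mu))
    (hU : InjOn toTorus (gaussRegion σ (a + β / 2) (b + β))) (hV : IsTangent V σ a b)
    (hVU : ∀ q ∉ toTorus '' gaussRegion σ (a + β / 2) (b + β),
      V q = (Real.sin φ, Real.cos φ) ∨ V q = -(Real.sin φ, Real.cos φ))
    (hB1 : 3 * (σ * √(4 * Real.log lam / (1 - mu ^ 2)) + b) < ε)
    (hB2 : β < ε / 7 ∧ β ≤ (lam - 1) * b) (q : Torus) :
    ∃ u ∈ Icc (-1 : ℝ) 1, ∃ n x, |x| < a ∧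
      catMap^[n] (V.flow (catMap q) (ε * u)) = toTorus (x, 0) := by
  have ha0 : 0 < a := by rw [ha, one_sub_mu]; exact div_pos hε (by linarith [tau_bounds.1])
  obtain ⟨p, hp⟩ := toTorus_surjective (catMap q)
  suffices h : ∃ t ∈ Icc (-ε) ε, ∃ n x, |x| < a ∧
      catMap^[n] (toTorus (V.planeFlow p t)) = toTorus (x, 0) by
    obtain ⟨t, ht, n, x, hx, hn⟩ := h
    refine ⟨t / ε, ⟨?_, ?_⟩, n, x, hx, ?_⟩
    · rw [le_div_iff₀ hε]; linarith [ht.1]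
    · rw [div_le_iff₀ hε]; linarith [ht.2]
    · rwa [← hp, V.flow_toTorus, mul_div_cancel₀ _ hε.ne']
  by_cases hh : ∀ t ∈ Icc (-ε) ε, (V.planeFlow p t).2 = p.2
  · obtain ⟨t, ht, x, hx, h⟩ :=
      exists_mem_segment_of_horizontal hε hb hβ hσ hφ ha hU hV hVU hB1 hB2 hh
    exact ⟨t, ht, 0, x, hx, h⟩
  · push Not at hh
    obtain ⟨t, ht, hne⟩ := hh
    have h0 : (0 : ℝ) ∈ Icc (-ε) ε := ⟨by linarith, hε.le⟩
    have hp0 : (V.planeFlow p 0).2 = p.2 := by rw [V.planeFlow_zero]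
    rw [← hp0] at hne
    obtain ⟨s, hs, t, ht, hlt⟩ : ∃ s ∈ Icc (-ε) ε, ∃ t ∈ Icc (-ε) ε,
        (V.planeFlow p s).2 < (V.planeFlow p t).2 := by
      rcases lt_or_gt_of_ne hne with h | h
      · exact ⟨t, ht, 0, h0, h⟩
      · exact ⟨0, h0, t, ht, h⟩
    obtain ⟨r, hr, n, x, hx, h⟩ := exists_iterate_mem_segment_of_lt V p ha0 hlt
    exact ⟨r, uIcc_subset_Icc hs ht hr, n, x, hx, h⟩

section decay

variable (inj : InjOn toTorus (gaussRegion σ a b)) (hb : 0 < b)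
  (hreach : ∀ q, ∃ u ∈ Icc (-1 : ℝ) 1, ∃ n x, |x| < a ∧
    catMap^[n] (V.flow (catMap q) (ε * u)) = toTorus (x, 0))
include inj hb

include hreach in
-- The potential need not be continuous, so it is bounded by `1 - ψ / 2` for a continuous bump `ψ`
-- around the reachable point of the segment. The iterates of `ψ` are continuous and positive at
-- `q`, hence bounded below near `q`.
lemma exists_eventually_iterate_step_potential_lt (q : Torus) :
    ∃ n, ∃ r < 1, ∀ᶠ q' in 𝓝 q, (step V ε)^[n] (potential σ a b) q' ≤ r := by
  obtain ⟨u, hu, n, x, hx, hn⟩ := hreach q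
  set O : Set (ℝ × ℝ) := {p | p ∈ gaussRegion σ a b ∧
    lam * |p.2| < (1 / 2) ^ 2 * (b * bell σ (mu * p.1))} with hO
  have hOo : IsOpen O := by
    have := continuous_bell (σ := σ)
    exact isOpen_gaussRegion.inter (isOpen_lt (f := fun p : ℝ × ℝ => lam * |p.2|)
      (g := fun p => (1 / 2) ^ 2 * (b * bell σ (mu * p.1))) (by fun_prop) (by fun_prop))
  have hxO : ((x, 0) : ℝ × ℝ) ∈ O := by
    refine ⟨⟨hx, ?_⟩, ?_⟩
    · rw [abs_zero, gauss_eq]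
      exact mul_pos hb (bell_pos _)
    · rw [abs_zero, mul_zero]
      have := bell_pos (σ := σ) (mu * x)
      positivity
  obtain ⟨ψ, hψ0, hψ1, hψ⟩ := exists_continuous_zero_one_of_isClosed
    (isOpenMap_toTorus O hOo).isClosed_compl (isClosed_singleton (x := toTorus (x, 0)))
    (Set.disjoint_singleton_right.2 fun h => h (mem_image_of_mem _ hxO))
  have hψabs : ∀ q, |ψ q| ≤ 1 := fun q => abs_le.2 ⟨by linarith [(hψ q).1], (hψ q).2⟩
  -- The extra step is the noisy one that selects `u`; the other `n` follow the Cat Map.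
  have hpos : 0 < (step V ε)^[n + 1] ψ q := by
    rw [Function.iterate_succ_apply']
    have hnn : ∀ q, 0 ≤ (step V ε)^[n] ψ q := by
      clear hn
      induction n with
      | zero => exact fun q => (hψ q).1
      | succ n ih =>
        rw [Function.iterate_succ_apply']
        exact step_nonneg V ε ih
    refine step_pos V ε (continuous_iterate_step V ε ψ.continuous n) hnn hu ?_
    refine iterate_step_pos ψ.continuous (fun q => (hψ q).1) n ?_
    rw [hn, hψ1 rfl]
    exact one_pos
  have hle : ∀ q, potential σ a b q ≤ 1 - 1 / 2 * ψ q := by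
    intro q
    by_cases hq : q ∈ toTorus '' O
    · obtain ⟨p, ⟨hp, hlt⟩, rfl⟩ := hq
      have h1 := potential_lt inj (by norm_num) hb hp hlt
      linarith [(hψ (toTorus p)).2]
    · have h1 := hψ0 hq
      rw [Pi.zero_apply] at h1
      rw [h1]
      linarith [(potential_mem inj q).2]
  have hm : Measurable fun q => 1 / 2 * ψ q := ψ.continuous.measurable.const_mul _
  have hmabs : ∀ q, |1 / 2 * ψ q| ≤ 1 := fun q =>
    abs_le.2 ⟨by linarith [(hψ q).1], by linarith [(hψ q).2]⟩
  have hbound : ∀ q, (step V ε)^[n + 1] (potential σ a b) q ≤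
      1 - 1 / 2 * (step V ε)^[n + 1] ψ q := by
    intro q
    have h1 := iterate_step_mono V ε (D := 1) (measurable_potential inj) (abs_potential_le inj)
      (hm.const_sub 1) (fun q => abs_le.2 ⟨by linarith [(abs_le.1 (hmabs q)).2],
        by linarith [(hψ q).1]⟩) hle (n + 1) q
    rwa [iterate_step_const_sub V ε 1 hm hmabs, iterate_step_const_mul V ε] at h1
  refine ⟨n + 1, 1 - 1 / 4 * (step V ε)^[n + 1] ψ q, by linarith, ?_⟩
  have hcont := (continuous_iterate_step V ε ψ.continuous (n + 1)).tendsto q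
  filter_upwards [hcont.eventually (lt_mem_nhds (half_lt_self hpos))] with q' hq'
  linarith [hbound q']

variable {s : ℝ} (hs : s ≤ 1)
  (hstep : ∀ q, potential σ a b q < 1 → step V ε (potential σ a b) q ≤ s * potential σ a b q)
include hs hstep

omit hb in
-- Where the potential is below `1` it decreases in the mean, and where it equals `1` it cannot
-- grow.
lemma antitone_iterate_step_potential (q : Torus) :
    Antitone fun n => (step V ε)^[n] (potential σ a b) q := by
  have hle : ∀ q, step V ε (potential σ a b) q ≤ potential σ a b q := by
    intro q
    rcases (potential_mem inj q).2.lt_or_eq with h | h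
    · refine (hstep q h).trans ?_
      nlinarith [(potential_mem inj q).1]
    · rw [h]
      exact (abs_le.1 (abs_step_le V ε (abs_potential_le inj) q)).2
  refine antitone_nat_of_succ_le fun n => ?_
  rw [Function.iterate_succ_apply]
  exact iterate_step_mono V ε (measurable_step V ε (measurable_potential inj))
    (abs_step_le V ε (abs_potential_le inj)) (measurable_potential inj)
    (abs_potential_le inj) hle n q

include hreach in
-- Monotonicity lets finitely many local bounds share one time `n`. After `n + 1` steps, points with
-- potential below `1` have gained the factor `s` from their first step, and the others the factor
-- `r`, so one multiplicative bound holds everywhere and can be iterated.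
lemma exists_iterate_step_potential_le (hs' : s < 1) :
    ∃ M, ∃ r < 1, 0 ≤ r ∧ ∀ q,
      (step V ε)^[M] (potential σ a b) q ≤ r * potential σ a b q := by
  have hanti := antitone_iterate_step_potential inj hs hstep
  obtain ⟨n, r, hr, h⟩ : ∃ n, ∃ r < 1, ∀ q ∈ (univ : Set Torus),
      (step V ε)^[n] (potential σ a b) q ≤ r := by
    refine isCompact_univ.induction_on
      (p := fun S => ∃ n, ∃ r < 1, ∀ q ∈ S, (step V ε)^[n] (potential σ a b) q ≤ r) ?_ ?_ ?_ ?_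
    · exact ⟨0, 0, one_pos, fun q hq => hq.elim⟩
    · rintro S T hST ⟨n, r, hr, h⟩
      exact ⟨n, r, hr, fun q hq => h q (hST hq)⟩
    · rintro S T ⟨n, r, hr, h⟩ ⟨n', r', hr', h'⟩
      refine ⟨max n n', max r r', max_lt hr hr', fun q hq => ?_⟩
      rcases hq with hq | hq
      · exact (hanti q (le_max_left n n')).trans ((h q hq).trans (le_max_left _ _))
      · exact (hanti q (le_max_right n n')).trans ((h' q hq).trans (le_max_right _ _))
    · intro q _
      obtain ⟨n, r, hr, h⟩ := exists_eventually_iterate_step_potential_lt inj hb hreach q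
      exact ⟨_, mem_nhdsWithin_of_mem_nhds h, n, r, hr, fun q hq => hq⟩
  refine ⟨n + 1, max 0 (max s r), max_lt one_pos (max_lt hs' hr), le_max_left _ _, fun q => ?_⟩
  have h0 := (potential_mem inj q).1
  rcases (potential_mem inj q).2.lt_or_eq with hq | hq
  · calc (step V ε)^[n + 1] (potential σ a b) q
        ≤ step V ε (potential σ a b) q := hanti q (Nat.le_add_left 1 n)
      _ ≤ s * potential σ a b q := hstep q hq
      _ ≤ _ := mul_le_mul_of_nonneg_right ((le_max_left _ _).trans (le_max_right _ _)) h0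
  · rw [hq, mul_one]
    exact (hanti q (Nat.le_succ n)).trans
      ((h q (mem_univ q)).trans ((le_max_right _ _).trans (le_max_right _ _)))

include hreach in
/-- The mean potential tends to zero uniformly. -/
lemma exists_forall_iterate_step_potential_le (hs' : s < 1) {δ : ℝ} (hδ : 0 < δ) :
    ∃ N, ∀ n ≥ N, ∀ q, (step V ε)^[n] (potential σ a b) q ≤ δ := by
  obtain ⟨M, r, hr, hr0, h⟩ := exists_iterate_step_potential_le inj hb hreach hs hstep hs'
  have hm := measurable_potential inj
  have hC := abs_potential_le inj
  have hj : ∀ j q, (step V ε)^[M * j] (potential σ a b) q ≤ r ^ j * potential σ a b q := by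
    intro j
    induction j with
    | zero => simp
    | succ j ih =>
      intro q
      have h1 := iterate_step_mono V ε (D := r ^ j) (measurable_iterate_step V ε hm (M * j))
        (abs_iterate_step_le V ε hC (M * j)) (hm.const_mul (r ^ j))
        (fun q => by
          rw [abs_mul, abs_of_nonneg (pow_nonneg hr0 j)]
          exact mul_le_of_le_one_right (pow_nonneg hr0 j) (hC q)) ih M q
      rw [iterate_step_const_mul V ε, ← Function.iterate_add_apply] at h1
      rw [mul_add_one, add_comm]
      refine h1.trans ?_
      rw [pow_succ, mul_assoc]
      exact mul_le_mul_of_nonneg_left (h q) (pow_nonneg hr0 j)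
  obtain ⟨j, hjδ⟩ := exists_pow_lt_of_lt_one hδ hr
  refine ⟨M * j, fun n hn q => ?_⟩
  refine (antitone_iterate_step_potential inj hs hstep q hn).trans ((hj j q).trans ?_)
  exact (mul_le_of_le_one_right (pow_nonneg hr0 j) (potential_mem inj q).2).trans hjδ.le

end decay

end

section

/-! ### The dynamics on the stable segment -/

variable {σ ε a b : ℝ} {V : UnitVectorField}

section segment

variable (hV : IsTangent V σ a b) (hσ : σ ≠ 0) (hb : 0 < b) (hε : 0 < ε)
  (ha : a = ε / (1 - mu))

lemma mu_mul_add (ha : a = ε / (1 - mu)) : mu * a + ε = a := by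
  have : 1 - mu ≠ 0 := by linarith [mu_lt_one]
  rw [ha]
  field_simp
  ring

lemma abs_integral_unif_le {h : ℝ → ℝ} {δ : ℝ} (hδ : ∀ u ∈ Icc (-1 : ℝ) 1, |h u| ≤ δ) :
    |∫ u, h u ∂unif| ≤ δ := by
  have := norm_integral_le_of_norm_le_const (μ := unif) (f := h) (C := δ)
    (ae_unif_mem.mono fun u hu => hδ u hu)
  simpa using this

lemma mu_mul_add_mem (hε : 0 < ε) (ha : a = ε / (1 - mu)) {x u : ℝ} (hx : x ∈ Icc (-a) a)
    (hu : u ∈ Icc (-1 : ℝ) 1) : mu * x + ε * u ∈ Icc (-a) a := by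
  have h := mu_mul_add ha
  have hmu := mu_pos
  constructor <;> nlinarith [hx.1, hx.2, hu.1, hu.2]

lemma continuous_toTorus_segment : Continuous fun x : ℝ => toTorus (x, 0) :=
  continuous_toTorus.comp (by fun_prop)

include hV hσ hb hε ha

/-- On the stable segment the dynamics is `x ↦ mu * x + ε * u` with `u` uniform. -/
lemma step_segment {h : Torus → ℝ} (hc : Continuous h) {x : ℝ} (hx : x ∈ Icc (-a) a) :
    step V ε h (toTorus (x, 0)) = ∫ u, h (toTorus (mu * x + ε * u, 0)) ∂unif := by
  have hmu := mu_pos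
  have ha0 : 0 < a := by
    rw [ha]
    exact div_pos hε (by linarith [mu_lt_one])
  have hopen : EqOn (fun x => step V ε h (toTorus (x, 0)))
      (fun x => ∫ u, h (toTorus (mu * x + ε * u, 0)) ∂unif) (Ioo (-a) a) := by
    intro x hx
    have hx' : |mu * x| + ε < a := by
      have h1 : |x| < a := abs_lt.2 hx
      rw [abs_mul, abs_of_pos hmu]
      linarith [mu_mul_add ha, mul_lt_mul_of_pos_left h1 hmu]
    have hcat : catMap (toTorus (x, 0)) = toTorus (mu * x, 0) := by
      rw [catMap_toTorus, mul_zero]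
    have hmem : ∀ u ∈ Icc (-1 : ℝ) 1, ε * u ∈ Icc (-ε) ε := fun u hu =>
      ⟨by nlinarith [hu.1], by nlinarith [hu.2]⟩
    simp only [step, hcat, V.flow_toTorus]
    rcases hV.planeFlow_zero_snd hσ hb hε.le hx' with hfl | hfl
    · refine integral_congr_ae ?_
      filter_upwards [ae_unif_mem] with u hu
      rw [hfl _ (hmem u hu)]
    -- The field may run along the segment in either direction; the symmetry of the noise makes this
    -- irrelevant.
    · rw [← integral_unif_neg]
      refine integral_congr_ae ?_
      filter_upwards [ae_unif_mem] with u hu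
      rw [hfl _ (hmem _ ⟨by linarith [hu.2], by linarith [hu.1]⟩), mul_neg, sub_neg_eq_add]
  have hc1 : Continuous fun x => step V ε h (toTorus (x, 0)) :=
    (continuous_step V ε hc).comp continuous_toTorus_segment
  have hc2 : Continuous fun x : ℝ => ∫ u, h (toTorus (mu * x + ε * u, 0)) ∂unif := by
    obtain ⟨C, hC⟩ := isCompact_univ.exists_bound_of_continuousOn hc.continuousOn
    refine continuous_of_dominated (bound := fun _ => C) (fun x => ?_)
      (fun x => Eventually.of_forall fun u => hC _ (mem_univ _)) (integrable_const C)
      (Eventually.of_forall fun u => ?_)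
    · exact (hc.comp (continuous_toTorus_segment.comp
        (by fun_prop : Continuous fun u : ℝ => mu * x + ε * u))).measurable.aestronglyMeasurable
    · exact hc.comp (continuous_toTorus_segment.comp
        (by fun_prop : Continuous fun x : ℝ => mu * x + ε * u))
  -- For `x = ± a` the arc touches the side of the region, so these two points are reached by
  -- continuity.
  have hcl := hopen.closure hc1 hc2
  rw [closure_Ioo (by linarith)] at hcl
  exact hcl hx

/-- Coupling: two copies of the chain driven by the same `u` approach each other by the factor `mu`
at each step. -/
lemma abs_iterate_step_sub_le {h : Torus → ℝ} (hc : Continuous h) {d δ : ℝ}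
    (hd : ∀ x ∈ Icc (-a) a, ∀ x' ∈ Icc (-a) a, |x - x'| ≤ d →
      |h (toTorus (x, 0)) - h (toTorus (x', 0))| ≤ δ) (k : ℕ) :
    ∀ x ∈ Icc (-a) a, ∀ x' ∈ Icc (-a) a, mu ^ k * |x - x'| ≤ d →
      |(step V ε)^[k] h (toTorus (x, 0)) - (step V ε)^[k] h (toTorus (x', 0))| ≤ δ := by
  induction k with
  | zero => simpa using hd
  | succ k ih =>
    intro x hx x' hx' hxx
    have hck := continuous_iterate_step V ε hc k
    have hint : ∀ x : ℝ, Integrable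
        (fun u => (step V ε)^[k] h (toTorus (mu * x + ε * u, 0))) unif := by
      obtain ⟨C, hC⟩ := isCompact_univ.exists_bound_of_continuousOn hck.continuousOn
      exact fun x => integrable_of_bound (hck.comp (continuous_toTorus_segment.comp
        (by fun_prop : Continuous fun u : ℝ => mu * x + ε * u))).measurable
        fun _ => hC _ (mem_univ _)
    rw [Function.iterate_succ_apply', step_segment hV hσ hb hε ha hck hx,
      step_segment hV hσ hb hε ha hck hx', ← integral_sub (hint x) (hint x')]
    refine abs_integral_unif_le fun u hu => ?_
    refine ih _ (mu_mul_add_mem hε ha hx hu) _ (mu_mul_add_mem hε ha hx' hu) ?_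
    rw [add_sub_add_right_eq_sub, ← mul_sub, abs_mul, abs_of_pos mu_pos, ← mul_assoc, ← pow_succ]
    exact hxx

/-- The segment is invariant under the chain, and averaging preserves closeness to a constant. -/
lemma abs_iterate_step_sub_const_le {h : Torus → ℝ} (hc : Continuous h) {c δ : ℝ}
    (hd : ∀ x ∈ Icc (-a) a, |h (toTorus (x, 0)) - c| ≤ δ) (k : ℕ) :
    ∀ x ∈ Icc (-a) a, |(step V ε)^[k] h (toTorus (x, 0)) - c| ≤ δ := by
  induction k with
  | zero => simpa using hd
  | succ k ih =>
    intro x hx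
    have hck := continuous_iterate_step V ε hc k
    have hint : Integrable (fun u => (step V ε)^[k] h (toTorus (mu * x + ε * u, 0))) unif := by
      obtain ⟨C, hC⟩ := isCompact_univ.exists_bound_of_continuousOn hck.continuousOn
      exact integrable_of_bound (hck.comp (continuous_toTorus_segment.comp
        (by fun_prop : Continuous fun u : ℝ => mu * x + ε * u))).measurable
        fun _ => hC _ (mem_univ _)
    have hcc : c = ∫ _, c ∂unif := by simp
    rw [Function.iterate_succ_apply', step_segment hV hσ hb hε ha hck hx, hcc,
      ← integral_sub hint (integrable_const _)]
    exact abs_integral_unif_le fun u hu => ih _ (mu_mul_add_mem hε ha hx hu)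

/-- The iterates of the Markov operator flatten a function on the stable segment. -/
lemma exists_forall_iterate_step_sub_le {h : Torus → ℝ} (hc : Continuous h) {δ : ℝ}
    (hδ : 0 < δ) :
    ∃ k, ∀ n ≥ k, ∀ x ∈ Icc (-a) a, ∀ x' ∈ Icc (-a) a,
      |(step V ε)^[n] h (toTorus (x, 0)) - (step V ε)^[k] h (toTorus (x', 0))| ≤ δ := by
  have huc := isCompact_Icc.uniformContinuousOn_of_continuous (s := Icc (-a) a)
    (hc.comp continuous_toTorus_segment).continuousOn
  obtain ⟨d, hd0, hd⟩ := Metric.uniformContinuousOn_iff.1 huc δ hδ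
  have htm := (tendsto_pow_atTop_nhds_zero_of_lt_one mu_pos.le mu_lt_one).mul_const (2 * a)
  rw [zero_mul] at htm
  obtain ⟨k, hk⟩ := (htm.eventually_lt_const (show 0 < d / 2 by positivity)).exists
  have hosc := abs_iterate_step_sub_le hV hσ hb hε ha hc (d := d / 2) (δ := δ)
    (fun x hx x' hx' hxx => (hd x hx x' hx'
      (by rw [Real.dist_eq]; linarith)).le) k
  refine ⟨k, fun n hn x hx x' hx' => ?_⟩
  obtain ⟨j, rfl⟩ := Nat.exists_eq_add_of_le' hn
  rw [Function.iterate_add_apply]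
  refine abs_iterate_step_sub_const_le hV hσ hb hε ha (continuous_iterate_step V ε hc k)
    (fun z hz => hosc z hz x' hx' ?_) j x hx
  refine le_trans ?_ hk.le
  have : |z - x'| ≤ 2 * a := abs_le.2 ⟨by linarith [hz.1, hx'.2], by linarith [hz.2, hx'.1]⟩
  exact mul_le_mul_of_nonneg_left this (pow_nonneg mu_pos.le k)

/-- The iterates of the Markov operator converge on the stable segment to the mean with respect
to a probability measure. -/
lemma exists_limit_measure : ∃ m : ProbabilityMeasure Torus,
    ∀ h : Torus → ℝ, Continuous h → ∀ δ > 0, ∃ k, ∀ n ≥ k, ∀ x ∈ Icc (-a) a,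
      |(step V ε)^[n] h (toTorus (x, 0)) - ∫ q, h q ∂(m : Measure Torus)| ≤ δ := by
  have ha0 : 0 < a := by
    rw [ha]
    exact div_pos hε (by linarith [mu_lt_one])
  have h0 : (0 : ℝ) ∈ Icc (-a) a := ⟨by linarith, ha0.le⟩
  set ν : ProbabilityMeasure Torus := ⟨Measure.dirac (toTorus (0, 0)), inferInstance⟩
  -- Any cluster point of the orbit of a point mass on the segment will do: flattening upgrades
  -- clustering to uniform convergence.
  obtain ⟨m, hm⟩ := exists_clusterPt_of_compactSpace (map (fun n => (push V ε)^[n] ν) atTop)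
  refine ⟨m, fun h hc δ hδ => ?_⟩
  obtain ⟨C, hC⟩ := isCompact_univ.exists_bound_of_continuousOn hc.continuousOn
  have hC' : ∀ q, |h q| ≤ C := fun q => hC q (mem_univ q)
  obtain ⟨k, hk⟩ := exists_forall_iterate_step_sub_le hV hσ hb hε ha hc (half_pos hδ)
  have hcont : Continuous fun ρ : ProbabilityMeasure Torus => ∫ q, h q ∂(ρ : Measure Torus) :=
    ProbabilityMeasure.continuous_integral_boundedContinuousFunction
      (BoundedContinuousFunction.mkOfCompact ⟨h, hc⟩)
  have hcl : MapClusterPt (∫ q, h q ∂(m : Measure Torus)) atTop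
      fun n => (step V ε)^[n] h (toTorus (0, 0)) := by
    have h1 := MapClusterPt.continuousAt_comp hcont.continuousAt hm
    convert h1 using 2 with n
    simp only [Function.comp_apply]
    rw [integral_iterate_push V ε hc.measurable hC']
    exact (integral_dirac' _ _ (measurable_iterate_step V ε hc.measurable n).stronglyMeasurable).symm
  have hlim : ∀ x' ∈ Icc (-a) a,
      |∫ q, h q ∂(m : Measure Torus) - (step V ε)^[k] h (toTorus (x', 0))| ≤ δ / 2 := by
    intro x' hx'
    have hclosed : IsClosed {z | |z - (step V ε)^[k] h (toTorus (x', 0))| ≤ δ / 2} :=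
      isClosed_le (by fun_prop) continuous_const
    refine hclosed.mem_of_mapClusterPt hcl ?_
    filter_upwards [eventually_ge_atTop k] with n hn using hk n hn 0 h0 x' hx'
  refine ⟨k, fun n hn x hx => ?_⟩
  have h1 := abs_le.1 (hk n hn x hx 0 h0)
  have h2 := abs_le.1 (hlim 0 h0)
  exact abs_le.2 ⟨by linarith [h1.1, h2.2], by linarith [h1.2, h2.1]⟩

end segment

/-! ### The stable segment -/

lemma isCompact_stableSegment : IsCompact (stableSegment a) :=
  (isCompact_Icc.prod isCompact_singleton).image continuous_toTorus

lemma mem_stableSegment {q : Torus} :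
    q ∈ stableSegment a ↔ ∃ x ∈ Icc (-a) a, toTorus (x, 0) = q := by
  constructor
  · rintro ⟨⟨x, y⟩, ⟨hx, rfl⟩, rfl⟩
    exact ⟨x, hx, rfl⟩
  · rintro ⟨x, hx, rfl⟩
    exact ⟨(x, 0), ⟨hx, rfl⟩, rfl⟩

/-- By Fubini it suffices that each fibre is countable: the first torus coordinate determines `x` up
to one integer. -/
lemma volume_stableSegment : volume (stableSegment a) = 0 := by
  have hs : √(1 + tau ^ 2) ≠ 0 := (Real.sqrt_pos.2 one_add_tau_sq_pos).ne'
  rw [Measure.volume_eq_prod, Measure.measure_prod_null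
    isCompact_stableSegment.isClosed.measurableSet]
  refine Eventually.of_forall fun r => ?_
  obtain ⟨r, rfl⟩ := QuotientAddGroup.mk_surjective r
  have : NullSingletonClass (volume : Measure UnitAddCircle) := ⟨fun x => by
    rw [← Metric.closedBall_zero, AddCircle.volume_closedBall]
    simp⟩
  refine Set.Countable.measure_zero ?_ _
  refine (countable_range fun n : ℤ =>
    ((-((r + n) / tau) : ℝ) : UnitAddCircle)).mono fun s hs' => ?_
  obtain ⟨x, -, hx⟩ := mem_stableSegment.1 hs'
  have h1 : (((-tau * x + 0) / √(1 + tau ^ 2) : ℝ) : UnitAddCircle) = (r : UnitAddCircle) :=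
    congrArg Prod.fst hx
  have h2 : (((x + tau * 0) / √(1 + tau ^ 2) : ℝ) : UnitAddCircle) = s := congrArg Prod.snd hx
  rw [← sub_eq_zero, ← AddCircle.coe_sub, AddCircle.coe_eq_zero_iff] at h1
  obtain ⟨n, hn⟩ := h1
  have ht : tau ≠ 0 := by linarith [tau_bounds.1]
  refine ⟨n, ?_⟩
  rw [← h2]
  dsimp only
  congr 1
  rw [zsmul_one] at hn
  rw [hn]
  field_simp
  ring

end

section

/-! ### Convergence to the invariant measure -/

variable {σ ε a b : ℝ} {V : UnitVectorField}

lemma exists_bound {h : Torus → ℝ} (hc : Continuous h) : ∃ C, ∀ q, |h q| ≤ C := by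
  obtain ⟨C, hC⟩ := isCompact_univ.exists_bound_of_continuousOn hc.continuousOn
  exact ⟨C, fun q => hC q (mem_univ q)⟩

/-- A continuous function is small on the stable segment up to a multiple of the potential. -/
lemma exists_abs_le_add_potential (inj : InjOn toTorus (gaussRegion σ a b)) (hb : 0 < b)
    {g : Torus → ℝ} (hg : Continuous g) {δ : ℝ} (hδ : 0 < δ)
    (hseg : ∀ x ∈ Icc (-a) a, |g (toTorus (x, 0))| ≤ δ) :
    ∃ C, 0 ≤ C ∧ ∀ q, |g q| ≤ 2 * δ + C * potential σ a b q := by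
  obtain ⟨D, hD⟩ := exists_bound hg
  have hD0 : 0 ≤ D := (abs_nonneg _).trans (hD 0)
  have huc := ((isCompact_Icc (a := -a) (b := a)).prod (isCompact_Icc (a := (-1 : ℝ))
    (b := 1))).uniformContinuousOn_of_continuous (hg.comp continuous_toTorus).continuousOn
  obtain ⟨ρ, hρ0, hρ⟩ := Metric.uniformContinuousOn_iff.1 huc δ hδ
  -- The outer `1` keeps `η` in the range where the potential is not cut off and gives `η ^ 2 ≤ η`;
  -- the inner one keeps the point in the rectangle of uniform continuity.
  set η := min 1 (min ρ 1 / b) with hη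
  have hη0 : 0 < η := by positivity
  refine ⟨D / η, by positivity, fun q => ?_⟩
  have hv := (potential_mem inj q).1
  rcases lt_or_ge (potential σ a b q) η with hq | hq
  · obtain ⟨p, hp, rfl, hlt, -⟩ := exists_of_potential_lt inj (min_le_left _ _) hb hq
    have hp2 : |p.2| < min ρ 1 := by
      have h1 := bell_pos (σ := σ) (mu * p.1)
      have h2 := bell_le_one (σ := σ) (mu * p.1)
      calc |p.2| ≤ lam * |p.2| := le_mul_of_one_le_left (abs_nonneg _) one_lt_lam.le
        _ < η ^ 2 * (b * bell σ (mu * p.1)) := hlt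
        _ ≤ η * (b * 1) := by
          refine mul_le_mul ?_ (by gcongr) (by positivity) hη0.le
          rw [sq]
          exact mul_le_of_le_one_left hη0.le (min_le_left _ _)
        _ ≤ min ρ 1 / b * (b * 1) := by gcongr; exact min_le_right _ _
        _ = min ρ 1 := by field_simp
    have hp1 : p.1 ∈ Icc (-a) a := abs_le.1 hp.1.le
    have hclose := hρ p ⟨hp1, abs_le.1 (hp2.le.trans (min_le_right _ _))⟩ (p.1, 0)
      ⟨hp1, by simp⟩ (by
        rw [Prod.dist_eq, dist_self, Real.dist_eq, sub_zero, max_eq_right (abs_nonneg _)]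
        exact hp2.trans_le (min_le_left _ _))
    rw [Real.dist_eq] at hclose
    have h3 : |g (toTorus p)| ≤ 2 * δ := by
      have h4 := abs_le.1 (hseg p.1 hp1)
      have h5 := abs_lt.1 hclose
      simp only [Function.comp_apply] at h5
      exact abs_le.2 ⟨by linarith [h4.1, h5.1], by linarith [h4.2, h5.2]⟩
    have : 0 ≤ D / η * potential σ a b (toTorus p) := by positivity
    linarith
  · have h1 : D ≤ D / η * potential σ a b q := by
      rw [div_mul_eq_mul_div, le_div_iff₀ hη0]
      exact mul_le_mul_of_nonneg_left hq hD0
    linarith [hD q]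

section limit

variable {m : ProbabilityMeasure Torus}
  (hm : ∀ h : Torus → ℝ, Continuous h → ∀ δ > 0, ∃ k, ∀ n ≥ k, ∀ x ∈ Icc (-a) a,
    |(step V ε)^[n] h (toTorus (x, 0)) - ∫ q, h q ∂(m : Measure Torus)| ≤ δ)
include hm

/-- Split the time: the early steps make the mean potential small, and the last `k` replace `h` by a
function nearly constant on the segment, whose error elsewhere is controlled by the potential. -/
lemma tendsto_integral_iterate_push (inj : InjOn toTorus (gaussRegion σ a b)) (hb : 0 < b)
    (hdecay : ∀ δ > 0, ∃ N, ∀ n ≥ N, ∀ q, (step V ε)^[n] (potential σ a b) q ≤ δ)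
    (ν : ProbabilityMeasure Torus) {h : Torus → ℝ} (hc : Continuous h) :
    Tendsto (fun n => ∫ q, h q ∂((push V ε)^[n] ν : Measure Torus)) atTop
      (𝓝 (∫ q, h q ∂(m : Measure Torus))) := by
  set c := ∫ q, h q ∂(m : Measure Torus) with hcdef
  rw [Metric.tendsto_atTop]
  intro δ hδ
  obtain ⟨k, hk⟩ := hm h hc (δ / 4) (by positivity)
  have hck := continuous_iterate_step V ε hc k
  have hgc : Continuous fun q => (step V ε)^[k] h q - c := hck.sub continuous_const
  obtain ⟨C, hC0, hC⟩ := exists_abs_le_add_potential inj hb hgc (by positivity : 0 < δ / 4)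
    fun x hx => hk k le_rfl x hx
  -- `C + 1` instead of `C`, since `C` may vanish.
  obtain ⟨N, hN⟩ := hdecay (δ / 4 / (C + 1)) (by positivity)
  refine ⟨k + N, fun n hn => ?_⟩
  obtain ⟨j, rfl⟩ := Nat.exists_eq_add_of_le hn
  set ρ := (push V ε)^[N + j] ν with hρ
  obtain ⟨B, hB⟩ := exists_bound hc
  obtain ⟨G, hG⟩ := exists_bound hgc
  have hmp := measurable_potential inj
  have h1 : ∫ q, h q ∂((push V ε)^[k + N + j] ν : Measure Torus) - c =
      ∫ q, ((step V ε)^[k] h q - c) ∂(ρ : Measure Torus) := by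
    rw [add_assoc, Function.iterate_add_apply, integral_iterate_push V ε hc.measurable hB,
      integral_sub (integrable_of_bound hck.measurable (abs_iterate_step_le V ε hB k))
      (integrable_const _)]
    simp [hρ]
  have h2 : ∫ q, potential σ a b q ∂(ρ : Measure Torus) ≤ δ / 4 / (C + 1) := by
    rw [hρ, integral_iterate_push V ε hmp (abs_potential_le inj)]
    calc _ ≤ ∫ _, δ / 4 / (C + 1) ∂(ν : Measure Torus) :=
          integral_mono (integrable_of_bound (measurable_iterate_step V ε hmp _)
            (abs_iterate_step_le V ε (abs_potential_le inj) _)) (integrable_const _)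
            (hN (N + j) (Nat.le_add_right _ _))
      _ = _ := by simp
  have hpi : Integrable (potential σ a b) (ρ : Measure Torus) :=
    integrable_of_bound hmp (abs_potential_le inj)
  rw [Real.dist_eq, h1]
  calc |∫ q, ((step V ε)^[k] h q - c) ∂(ρ : Measure Torus)|
      ≤ ∫ q, |(step V ε)^[k] h q - c| ∂(ρ : Measure Torus) := abs_integral_le_integral_abs
    _ ≤ ∫ q, (2 * (δ / 4) + C * potential σ a b q) ∂(ρ : Measure Torus) :=
        integral_mono (integrable_of_bound hgc.measurable hG).abs
          ((integrable_const _).add (hpi.const_mul C)) hC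
    _ = δ / 2 + C * ∫ q, potential σ a b q ∂(ρ : Measure Torus) := by
        rw [integral_add (integrable_const _) (hpi.const_mul C), integral_const,
          integral_const_mul, probReal_univ, one_smul]
        ring
    _ ≤ δ / 2 + (C + 1) * (δ / 4 / (C + 1)) := by
        have h3 : 0 ≤ δ / 4 / (C + 1) := by positivity
        nlinarith [mul_le_mul_of_nonneg_left h2 hC0]
    _ < δ := by
        rw [mul_div_cancel₀ _ (by positivity)]
        linarith

/-- The sequences for `step V ε h` and for `h` differ by a shift of the index, so they have the same
limit. -/
lemma push_eq_of_limit (ha : 0 ≤ a) : push V ε m = m := by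
  have h0 : (0 : ℝ) ∈ Icc (-a) a := ⟨by linarith, ha⟩
  have hlim : ∀ h : Torus → ℝ, Continuous h →
      Tendsto (fun n => (step V ε)^[n] h (toTorus (0, 0))) atTop
        (𝓝 (∫ q, h q ∂(m : Measure Torus))) := by
    intro h hc
    rw [Metric.tendsto_atTop]
    intro δ hδ
    obtain ⟨k, hk⟩ := hm h hc (δ / 2) (by positivity)
    exact ⟨k, fun n hn => (hk n hn 0 h0).trans_lt (by linarith)⟩
  refine Subtype.ext (ext_of_forall_integral_eq_of_IsFiniteMeasure
    (μ := (push V ε m : Measure Torus)) (ν := (m : Measure Torus)) fun h => ?_)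
  obtain ⟨C, hC⟩ := exists_bound h.continuous
  refine (integral_push V ε h.continuous.measurable hC m).trans ?_
  refine tendsto_nhds_unique (hlim _ (continuous_step V ε h.continuous)) ?_
  exact ((tendsto_add_atTop_iff_nat 1).2 (hlim h h.continuous)).congr fun n =>
    by rw [Function.iterate_succ_apply]

/-- The distance to the segment vanishes on it and so do its iterates there; its mean under `m` is
therefore zero. -/
lemma measure_compl_stableSegment (hV : IsTangent V σ a b) (hσ : σ ≠ 0) (hb : 0 < b)
    (hε : 0 < ε) (ha : a = ε / (1 - mu)) : (m : Measure Torus) (stableSegment a)ᶜ = 0 := by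
  have ha0 : 0 ≤ a := by
    rw [ha]
    exact div_nonneg hε.le (by linarith [mu_lt_one])
  have h0 : (0 : ℝ) ∈ Icc (-a) a := ⟨by linarith, ha0⟩
  set S := stableSegment a
  have hS : IsClosed S := isCompact_stableSegment.isClosed
  have hne : S.Nonempty := ⟨_, mem_stableSegment.2 ⟨0, h0, rfl⟩⟩
  set d : Torus → ℝ := fun q => Metric.infDist q S with hd
  have hdc : Continuous d := Metric.continuous_infDist_pt S
  have hseg : ∀ x ∈ Icc (-a) a, |d (toTorus (x, 0)) - 0| ≤ 0 := fun x hx => by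
    have : d (toTorus (x, 0)) = 0 :=
      Metric.infDist_zero_of_mem (mem_stableSegment.2 ⟨x, hx, rfl⟩)
    simp [this]
  have hint : ∫ q, d q ∂(m : Measure Torus) = 0 := by
    refine abs_eq_zero.1 (le_antisymm (le_of_forall_pos_le_add fun δ hδ => ?_) (abs_nonneg _))
    obtain ⟨k, hk⟩ := hm d hdc δ hδ
    have h1 := hk k le_rfl 0 h0
    have h2 := abs_iterate_step_sub_const_le hV hσ hb hε ha hdc hseg k 0 h0
    rw [sub_zero, abs_nonpos_iff] at h2
    rw [h2, zero_sub, abs_neg] at h1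
    linarith
  obtain ⟨C, hC⟩ := exists_bound hdc
  rw [integral_eq_zero_iff_of_nonneg (fun q => Metric.infDist_nonneg)
    (integrable_of_bound hdc.measurable hC)] at hint
  refine measure_mono_null (fun q hq => ?_) (ae_iff.1 hint)
  intro h
  exact hq ((hS.mem_iff_infDist_zero hne).2 h)

end limit

lemma integral_cesaro (ν : ProbabilityMeasure Torus) (n : ℕ) {h : Torus → ℝ} (hc : Continuous h) :
    ∫ q, h q ∂(cesaro V ε ν n : Measure Torus) =
      (n : ℝ)⁻¹ * ∑ i ∈ Finset.range n, ∫ q, h q ∂((push V ε)^[i] ν : Measure Torus) := by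
  obtain ⟨C, hC⟩ := exists_bound hc
  rw [cesaro, FiniteMeasure.toMeasure_smul, FiniteMeasure.toMeasure_sum]
  rw [integral_smul_nnreal_measure, integral_finsetSum_measure
    fun i _ => integrable_of_bound hc.measurable hC]
  simp [NNReal.smul_def]

end

end CatMap

end

/-! ### Conclusion: invariance, singularity, uniqueness and limits -/

theorem mainTheorem1 (ε a b β σ φ : ℝ)
    (hε : 0 < ε) (hb : 0 < b) (hβ : 0 < β) (hσ : 0 < σ)
    (hφ : φ ∈ Set.Ioo (-(Real.pi / 2)) (Real.pi / 2))
    (ha : a = ε / (1 - CatMap.mu))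
    -- the region bounded by `x = ± (a + β / 2)`, `y = ± (b + β) exp (-x² / 2σ²)` embeds in the
    -- torus; its image is the neighborhood `U'`
    (hU : Set.InjOn CatMap.toTorus (CatMap.gaussRegion σ (a + β / 2) (b + β)))
    (V : CatMap.UnitVectorField)
    -- in `W`, the field is tangent to the curves `y = K exp (-x² / 2σ²)`
    (hVW : ∀ K x : ℝ, (x, CatMap.gauss σ K x) ∈ CatMap.gaussRegion σ a b →
      ∃ c : ℝ, V (CatMap.toTorus (x, CatMap.gauss σ K x)) =
        c • ((1 : ℝ), deriv (CatMap.gauss σ K) x))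
    -- outside `U'`, the field makes the angle `φ` with the unstable direction `(0, 1)`
    (hVU : ∀ q ∉ CatMap.toTorus '' CatMap.gaussRegion σ (a + β / 2) (b + β),
      V q = (Real.sin φ, Real.cos φ) ∨ V q = -(Real.sin φ, Real.cos φ))
    (hB1 : 3 * (σ * √(4 * Real.log CatMap.lam / (1 - CatMap.mu ^ 2)) + b) < ε)
    (hB2 : β < ε / 7 ∧ β ≤ (CatMap.lam - 1) * b)
    (hB3 : ε * Real.sin φ / (1 - CatMap.mu) +
      (b + β) * Real.exp (-(a + β) ^ 2 / (2 * σ ^ 2)) * Real.tan φ < 1 / 4 * β) :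
    ∃ m : ProbabilityMeasure CatMap.Torus,
      CatMap.push V ε m = m ∧
      (m : Measure CatMap.Torus) ⟂ₘ volume ∧
      (m : Measure CatMap.Torus) (CatMap.stableSegment a)ᶜ = 0 ∧
      (∀ ρ : ProbabilityMeasure CatMap.Torus, CatMap.push V ε ρ = ρ → ρ = m) ∧
      ∀ ν : ProbabilityMeasure CatMap.Torus,
        (∀ ρ : ProbabilityMeasure CatMap.Torus,
          MapClusterPt ρ atTop (fun n : ℕ => (CatMap.push V ε)^[n] ν) →
            (ρ : Measure CatMap.Torus) (CatMap.stableSegment a)ᶜ = 0) ∧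
        Tendsto (CatMap.cesaro V ε ν) atTop (𝓝 m.toFiniteMeasure) := by
  have hmu : 0 < 1 - CatMap.mu := by linarith [CatMap.mu_lt_one]
  have ha0 : 0 ≤ a := by rw [ha]; positivity
  have hV : CatMap.IsTangent V σ a b := hVW
  have inj : InjOn CatMap.toTorus (CatMap.gaussRegion σ a b) := by
    refine hU.mono fun p hp => CatMap.mem_gaussRegion.2 ⟨hp.1.trans (by linarith), hp.2.trans ?_⟩
    exact mul_lt_mul_of_pos_right (by linarith) (CatMap.bell_pos _)
  have hreach := CatMap.exists_reach_segment hε hb hβ hσ hφ ha hU hV hVU hB1 hB2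
  have htau : CatMap.tau + 1 / 3 < 1 := by linarith [CatMap.tau_bounds.2]
  have hdecay : ∀ δ > 0, ∃ N, ∀ n ≥ N, ∀ q,
      (CatMap.step V ε)^[n] (CatMap.potential σ a b) q ≤ δ := fun δ hδ =>
    CatMap.exists_forall_iterate_step_potential_le inj hb hreach htau.le
      (fun q hq => CatMap.step_potential_le inj hV hε hb hσ ha hB1 hq) htau hδ
  obtain ⟨m, hm⟩ := CatMap.exists_limit_measure hV hσ.ne' hb hε ha
  have hinv := CatMap.push_eq_of_limit hm ha0
  have hsupp := CatMap.measure_compl_stableSegment hm hV hσ.ne' hb hε ha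
  have hint : ∀ (ν : ProbabilityMeasure CatMap.Torus) (h : CatMap.Torus → ℝ), Continuous h →
      Tendsto (fun n => ∫ q, h q ∂((CatMap.push V ε)^[n] ν : Measure CatMap.Torus)) atTop
        (𝓝 (∫ q, h q ∂(m : Measure CatMap.Torus))) := fun ν h hc =>
    CatMap.tendsto_integral_iterate_push hm inj hb hdecay ν hc
  -- The iterates themselves converge, without averaging; uniqueness, limit points and Cesàro
  -- averages all follow from this.
  have hconv : ∀ ν : ProbabilityMeasure CatMap.Torus,
      Tendsto (fun n : ℕ => (CatMap.push V ε)^[n] ν) atTop (𝓝 m) := fun ν =>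
    ProbabilityMeasure.tendsto_iff_forall_integral_tendsto.2 fun h => hint ν h h.continuous
  refine ⟨m, hinv, ?_, hsupp, fun ρ hρ => ?_, fun ν => ⟨fun ρ hρ => ?_, ?_⟩⟩
  · refine ⟨(CatMap.stableSegment a)ᶜ,
      CatMap.isCompact_stableSegment.isClosed.measurableSet.compl, hsupp, ?_⟩
    rw [compl_compl]
    exact CatMap.volume_stableSegment
  · refine tendsto_nhds_unique (tendsto_const_nhds.congr fun n => ?_) (hconv ρ)
    exact (Function.iterate_fixed hρ n).symm
  · have h := hρ.clusterPt.mono (hconv ν)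
    rwa [eq_of_nhds_neBot h]
  · refine FiniteMeasure.tendsto_iff_forall_integral_tendsto.2 fun h => ?_
    simp only [CatMap.integral_cesaro ν _ h.continuous]
    exact (hint ν h h.continuous).cesaro
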